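/- Small-bias minimax for expected query complexity fails. A randomised decision tree $R$ on $n$ input bits is a probability distribution over deterministic decision trees (which never query the same bit twice along a path). For a partial function $f\colon\{0,1\}^n\to\{0,1,*\}$ with domain $\mathrm{Dom}(f)=f^{-1}(\{0,1\})$, let $\mathrm{cost}(R,x)$ be the expected number of queries made by $R$ on input $x$, and let $\mathrm{err}_f(R,x)=\Pr[R(x)\neq f(x)]$. For a distribution $\mu$ on $\mathrm{Dom}(f)$ put $\mathrm{cost}(R,\mu)=\mathbb{E}_{x\sim\mu}[\mathrm{cost}(R,x)]$ and $\mathrm{err}_f(R,\mu)=\mathbb{E}_{x\sim\mu}[\mathrm{err}_f(R,x)]$. Define the $\varepsilon$-error expected query complexity and its distributional version by $$\overline{\mathrm R}_\varepsilon(f)=\min_{R:\ \mathrm{err}_f(R,x)\le\varepsilon\ \forall x\in\mathrm{Dom}(f)}\ \max_{x\in\mathrm{Dom}(f)}\mathrm{cost}(R,x),\qquad \overline{\mathrm D}_\varepsilon(f)=\max_{\mu}\ \min_{R:\ \mathrm{err}_f(R,\mu)\le\varepsilon}\mathrm{cost}(R,\mu),$$ where $R$ ranges over randomised decision trees and $\mu$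 over distributions on $\mathrm{Dom}(f)$. Theorem. There are a constant $c>0$, partial functions $f_n\colon\{0,1\}^n\to\{0,1,*\}$ and biases $\delta(n)\in(0,1)$ for $n\in\mathbb{N}$, with $\delta(n)\to0$ as $n\to\infty$, such that for all sufficiently large $n$ $$\overline{\mathrm R}_{(1-\delta(n))/2}(f_n)\ \ge\ \overline{\mathrm D}_{(1-\delta(n))/2}(f_n)^{\,1+c}\qquad\text{and}\qquad \overline{\mathrm R}_{(1-\delta(n))/2}(f_n)\ \ge\ n^{c}.$$ (In particular, the ratio of $\overline{\mathrm R}_{(1-\delta(n))/2}(f_n)$ to $\overline{\mathrm D}_{(1-\delta(n))/2}(f_n)$ is at least $n^{\Omega(1)}$, so the former is not characterised by a single hard distribution.) -/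

import Mathlib

open Filter Topology
open scoped ENNReal

namespace QueryComplexity

/-- Partial boolean functions `{0,1}ⁿ → {0,1,*}`; the value `none` plays the role of `*`. -/
abbrev PartialFn (n : ℕ) : Type := (Fin n → Bool) → Option Bool

/-- The domain `f⁻¹({0,1})` of a partial boolean function. -/
def PartialFn.Dom {n : ℕ} (f : PartialFn n) : Set (Fin n → Bool) := {x | f x ≠ none}

/-- Binary trees whose internal nodes are labelled by input positions and whose leaves are
labelled by output bits. -/
inductive Tree (n : ℕ) : Type
  | leaf (b : Bool) : Tree n
  | query (i : Fin n) (t₀ t₁ : Tree n) : Tree n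

/-- The label of the leaf reached on input `x`. -/
def Tree.eval {n : ℕ} : Tree n → (Fin n → Bool) → Bool
  | .leaf b, _ => b
  | .query i t₀ t₁, x => if x i = true then t₁.eval x else t₀.eval x

/-- The number of queries made on input `x`, that is, the depth of the leaf reached. -/
def Tree.cost {n : ℕ} : Tree n → (Fin n → Bool) → ℕ
  | .leaf _, _ => 0
  | .query i t₀ t₁, x => 1 + (if x i = true then t₁.cost x else t₀.cost x)

/-- No internal node has a label in `S`, and no internal node shares its label with an
ancestor. -/
def Tree.ReadOnceAvoiding {n : ℕ} : Tree n → Finset (Fin n) → Prop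
  | .leaf _, _ => True
  | .query i t₀ t₁, S =>
      i ∉ S ∧ t₀.ReadOnceAvoiding (insert i S) ∧ t₁.ReadOnceAvoiding (insert i S)

/-- Deterministic decision trees on `n` input bits: no internal node shares its label with an
ancestor. -/
abbrev DecisionTree (n : ℕ) : Type := {t : Tree n // t.ReadOnceAvoiding ∅}

/-- Randomised decision trees: probability distributions over deterministic decision trees. -/
abbrev RandTree (n : ℕ) : Type := PMF (DecisionTree n)

/-- The expectation of a nonnegative function under a discrete distribution. -/
noncomputable def expect {α : Type*} (p : PMF α) (g : α → ℝ≥0∞) : ℝ≥0∞ := ∑' a, p a * g a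

/-- `cost(R, x)`: the expected number of queries `R` makes on input `x`. -/
noncomputable def cost {n : ℕ} (R : RandTree n) (x : Fin n → Bool) : ℝ≥0∞ :=
  expect R fun T => (T.1.cost x : ℝ≥0∞)

/-- `err_f(R, x)`: the probability that `R(x) ≠ f(x)`. -/
noncomputable def err {n : ℕ} (f : PartialFn n) (R : RandTree n) (x : Fin n → Bool) : ℝ≥0∞ :=
  expect R fun T => if some (T.1.eval x) = f x then 0 else 1

/-- The `ε`-error expected query complexity: the least worst-case (over the domain) expected
cost of a randomised tree whose error is at most `ε` on every input of the domain. -/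
noncomputable def expR {n : ℕ} (ε : ℝ≥0∞) (f : PartialFn n) : ℝ≥0∞ :=
  ⨅ (R : RandTree n) (_ : ∀ x ∈ f.Dom, err f R x ≤ ε), ⨆ x ∈ f.Dom, cost R x

/-- The `ε`-error distributional expected query complexity: the largest, over distributions `μ`
on the domain, of the least expected cost under `μ` of a randomised tree whose expected error
under `μ` is at most `ε`. -/
noncomputable def expD {n : ℕ} (ε : ℝ≥0∞) (f : PartialFn n) : ℝ≥0∞ :=
  ⨆ μ : PMF f.Dom, ⨅ (R : RandTree n) (_ : expect μ (fun x => err f R x) ≤ ε),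
    expect μ (fun x => cost R x)

end QueryComplexity

/-! Let r be about n^(1/16). An input consists of r² flags, r⁴ payload bits and N ≥ r¹⁶/2 votes. On
plain inputs (no flag set) the answer is the majority of the votes, whose relative margin is at
least 1/(2r⁴). On flagged inputs (one flag set) it is the parity of the payload, and the votes may
mislead by a relative margin of up to 2/r³. The required bias is δ = 1/(4r⁴).

Upper bound. Polling a random vote costs 1 and gains bias of order 1/r⁴ on plain inputs. Probing a
random flag, and reading the payload if it is set, costs about r² on a flagged input but gains bias
of order 1/r², more than misleading votes can destroy. `cheapTree` does one or the other with equal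
probability, and on every input of the domain its cost is at most its bias divided by δ
(`mul_cost_cheapTree_add_le`). Given μ, run it with the probability t that makes the average bias
equal to δ and flip a coin otherwise: the average cost is at most 1 (`expD_le_one`). No small t
serves all μ, since plain inputs of least margin force t = 1, and then flagged inputs cost about
r²/2.

Lower bound. The measure `signed` combines plain inputs with votes of mean ±1/r⁴ and, with weight
1/r, flagged inputs whose votes have mean 1/r³ pointing away from the answer. Since 1/r⁴ =
(1/r)(1/r³), the evidence of the votes cancels to first order, and the parity is invisible until r⁴
payload bits are read. What survives (second-order terms, the imbalance caused by flags seen to be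
zero, the discovery of the set flag) amounts to a correlation of O(1/r⁵) per query. To make this
precise, `potential` dominates |`signed`| (`abs_signed_le_potential`) and grows in total by at most
14/r⁵ times the mass per query (`potential_reveal_add_le`); `Tree.abs_sum_sgn_le` turns this into a
bound on the correlation by the truncated cost. By Chebyshev the hard measures put mass only O(r⁸/N)
on atypical inputs, so bias δ on the whole domain needs cost of order r (`two_mul_bias_le`,
`le_expR`). -/

namespace QueryComplexity

/-! ### Partial inputs, additive functionals and the potential argument. -/

/-- The inputs compatible with the partial input `u`. -/
def cylinder {n : ℕ} (u : Fin n → Option Bool) : Finset (Fin n → Bool) :=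
  Finset.univ.filter fun x => ∀ i b, u i = some b → x i = b

/-- `u` with the coordinate `i` set to `b`. -/
def reveal {n : ℕ} (u : Fin n → Option Bool) (i : Fin n) (b : Bool) : Fin n → Option Bool :=
  Function.update u i (some b)

/-- The input `x` as a partial input that is defined everywhere. -/
def full {n : ℕ} (x : Fin n → Bool) : Fin n → Option Bool := fun i => some (x i)

/-- The sign `±1` of a bit. -/
def sgn (b : Bool) : ℝ := if b then 1 else -1

theorem abs_sgn (b : Bool) : |sgn b| = 1 := by cases b <;> simp [sgn]

theorem mem_cylinder {n : ℕ} {u : Fin n → Option Bool} {x : Fin n → Bool} :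
    x ∈ cylinder u ↔ ∀ i b, u i = some b → x i = b := by
  simp [cylinder]

theorem cylinder_reveal {n : ℕ} {u : Fin n → Option Bool} {i : Fin n} (hi : u i = none)
    (b : Bool) : cylinder (reveal u i b) = (cylinder u).filter fun x => x i = b := by
  ext x
  simp only [Finset.mem_filter, mem_cylinder]
  unfold reveal
  constructor
  · intro h
    refine ⟨fun j c hj => ?_, h i b (by simp)⟩
    have hne : j ≠ i := by rintro rfl; simp [hi] at hj
    exact h j c (by simpa [hne] using hj)
  · rintro ⟨h, hb⟩ j c hj
    by_cases hne : j = i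
    · subst hne
      simp at hj
      rw [hb, hj]
    · exact h j c (by simpa [hne] using hj)

theorem sum_cylinder_reveal {n : ℕ} {u : Fin n → Option Bool} {i : Fin n} (hi : u i = none)
    (F : (Fin n → Bool) → ℝ) :
    ∑ x ∈ cylinder u, F x =
      ∑ x ∈ cylinder (reveal u i false), F x + ∑ x ∈ cylinder (reveal u i true), F x := by
  rw [cylinder_reveal hi, cylinder_reveal hi,
    ← Finset.sum_filter_add_sum_filter_not (cylinder u) (fun x => x i = false)]
  simp

theorem cylinder_full {n : ℕ} (x : Fin n → Bool) : cylinder (full x) = {x} := by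
  ext y
  simp only [mem_cylinder, full, Finset.mem_singleton, Option.some.injEq]
  constructor
  · intro h; funext i; exact h i _ rfl
  · rintro rfl i b h; exact h

theorem cylinder_none {n : ℕ} : cylinder (fun _ : Fin n => none) = Finset.univ := by
  simp [cylinder]

/-- A functional that does not increase when a coordinate is revealed bounds its sum over the
compatible inputs. -/
theorem sum_full_le {n : ℕ} (Ψ : (Fin n → Option Bool) → ℝ)
    (h : ∀ u i, u i = none → Ψ (reveal u i false) + Ψ (reveal u i true) ≤ Ψ u)
    (u : Fin n → Option Bool) : ∑ x ∈ cylinder u, Ψ (full x) ≤ Ψ u := by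
  induction hk : (Finset.univ.filter fun i => u i = none).card generalizing u with
  | zero =>
    have hs : ∀ i, u i ≠ none := by
      simpa [Finset.card_eq_zero, Finset.filter_eq_empty_iff] using hk
    choose x hx using fun i => Option.ne_none_iff_exists'.mp (hs i)
    have : u = full x := funext hx
    rw [this, cylinder_full]
    simp
  | succ k ih =>
    obtain ⟨i, hi⟩ : (Finset.univ.filter fun i => u i = none).Nonempty := by
      rw [← Finset.card_pos]; omega
    have hi' : u i = none := by simpa using hi
    have hc : ∀ b, (Finset.univ.filter fun j => reveal u i b j = none).card = k := by
      intro b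
      have : (Finset.univ.filter fun j => reveal u i b j = none) =
          (Finset.univ.filter fun j => u j = none).erase i := by
        ext j
        simp only [Finset.mem_erase, Finset.mem_filter, Finset.mem_univ, true_and]
        by_cases hj : j = i
        · subst hj; simp [reveal]
        · simp [reveal, hj]
      rw [this, Finset.card_erase_of_mem hi, hk]; rfl
    rw [sum_cylinder_reveal hi']
    exact (add_le_add (ih _ (hc _)) (ih _ (hc _))).trans (h u i hi')

/-- The bound applies to both Ψ and −Ψ. Such a Ψ is a signed measure, recorded by its values on
cylinders. -/
theorem sum_full_eq {n : ℕ} (Ψ : (Fin n → Option Bool) → ℝ)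
    (h : ∀ u i, u i = none → Ψ (reveal u i false) + Ψ (reveal u i true) = Ψ u)
    (u : Fin n → Option Bool) : ∑ x ∈ cylinder u, Ψ (full x) = Ψ u := by
  refine le_antisymm (sum_full_le Ψ (fun u i hi => (h u i hi).le) u) ?_
  have := sum_full_le (fun u => -Ψ u) (fun u i hi => by rw [← h u i hi]; linarith) u
  simp only [Finset.sum_neg_distrib] at this
  linarith

/-- A potential argument: if `Φ` dominates the signed measure `σ`, and its total grows by at most
`κ M` when a coordinate is revealed (only while fewer than `tm` coordinates are known), then the
correlation of a decision tree with `σ` is bounded by `κ` times its truncated cost under `M`. -/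
theorem Tree.abs_sum_sgn_le {n : ℕ} (σ M Φ : (Fin n → Option Bool) → ℝ) (κ : ℝ)
    (t : (Fin n → Option Bool) → ℕ) (tm : ℕ)
    (hσ : ∀ u i, u i = none → σ (reveal u i false) + σ (reveal u i true) = σ u)
    (hM : ∀ u i, u i = none → M (reveal u i false) + M (reveal u i true) = M u)
    (ht : ∀ u i b, u i = none → t (reveal u i b) = t u + 1)
    (hΦ : ∀ u, |σ u| ≤ Φ u)
    (hstep : ∀ u i, u i = none →
      Φ (reveal u i false) + Φ (reveal u i true) ≤ Φ u + if t u < tm then κ * M u else 0)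
    (T : Tree n) (S : Finset (Fin n)) (hT : T.ReadOnceAvoiding S)
    (u : Fin n → Option Bool) (hu : ∀ i, i ∉ S → u i = none) :
    |∑ x ∈ cylinder u, σ (full x) * sgn (T.eval x)| ≤
      Φ u + κ * ∑ x ∈ cylinder u, M (full x) * ((min (T.cost x) (tm - t u) : ℕ) : ℝ) := by
  induction T generalizing S u with
  | leaf b =>
    simp only [Tree.eval, Tree.cost, Nat.zero_min, Nat.cast_zero, mul_zero, Finset.sum_const_zero,
      add_zero]
    rw [← Finset.sum_mul, sum_full_eq σ hσ, abs_mul, abs_sgn, mul_one]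
    exact hΦ u
  | query i t₀ t₁ ih₀ ih₁ =>
    obtain ⟨hi, h0, h1⟩ := hT
    have hui := hu i hi
    have hS : ∀ b j, j ∉ insert i S → reveal u i b j = none := by
      intro b j hj
      rw [Finset.mem_insert, not_or] at hj
      simp [reveal, hj.1, hu j hj.2]
    have I0 := ih₀ _ h0 _ (hS false)
    have I1 := ih₁ _ h1 _ (hS true)
    rw [ht u i _ hui] at I0 I1
    have hx : ∀ b, ∀ x ∈ cylinder (reveal u i b), x i = b := by
      intro b x hx
      rw [cylinder_reveal hui] at hx
      exact (Finset.mem_filter.mp hx).2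
    have e0 : ∑ x ∈ cylinder (reveal u i false), σ (full x) * sgn ((Tree.query i t₀ t₁).eval x) =
        ∑ x ∈ cylinder (reveal u i false), σ (full x) * sgn (t₀.eval x) :=
      Finset.sum_congr rfl fun x h => by simp [Tree.eval, hx _ x h]
    have e1 : ∑ x ∈ cylinder (reveal u i true), σ (full x) * sgn ((Tree.query i t₀ t₁).eval x) =
        ∑ x ∈ cylinder (reveal u i true), σ (full x) * sgn (t₁.eval x) :=
      Finset.sum_congr rfl fun x h => by simp [Tree.eval, hx _ x h]
    have c0 : ∀ x ∈ cylinder (reveal u i false),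
        (Tree.query i t₀ t₁).cost x = t₀.cost x + 1 := fun x h => by
      simp [Tree.cost, hx _ x h, add_comm]
    have c1 : ∀ x ∈ cylinder (reveal u i true),
        (Tree.query i t₀ t₁).cost x = t₁.cost x + 1 := fun x h => by
      simp [Tree.cost, hx _ x h, add_comm]
    rw [sum_cylinder_reveal hui, e0, e1, sum_cylinder_reveal hui (fun x => M (full x) * _)]
    have hs := hstep u i hui
    refine (abs_add_le _ _).trans ((add_le_add I0 I1).trans ?_)
    -- Before truncation the query adds one to the truncated cost on the whole cylinder, which pays
    -- for κ M u exactly. Afterwards the truncated cost is zero and the potential does not grow.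
    by_cases htm : t u < tm
    · have key : ∀ (b : Bool) (t' : Tree n),
          (∀ x ∈ cylinder (reveal u i b), (Tree.query i t₀ t₁).cost x = t'.cost x + 1) →
          ∑ x ∈ cylinder (reveal u i b),
            M (full x) * ((min ((Tree.query i t₀ t₁).cost x) (tm - t u) : ℕ) : ℝ) =
          ∑ x ∈ cylinder (reveal u i b),
            M (full x) * ((min (t'.cost x) (tm - (t u + 1)) : ℕ) : ℝ) + M (reveal u i b) := by
        intro b t' hc
        rw [← sum_full_eq M hM, ← Finset.sum_add_distrib]
        refine Finset.sum_congr rfl fun x h => ?_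
        rw [hc x h, show min (t'.cost x + 1) (tm - t u) = min (t'.cost x) (tm - (t u + 1)) + 1 by
          omega]
        push_cast; ring
      rw [key _ _ c0, key _ _ c1]
      rw [if_pos htm, ← hM u i hui] at hs
      linarith
    · have z1 : tm - t u = 0 := by omega
      have z2 : tm - (t u + 1) = 0 := by omega
      rw [if_neg htm] at hs
      simp only [z1, z2, Nat.min_zero, Nat.cast_zero, mul_zero, Finset.sum_const_zero]
      linarith

/-! ### Likelihood estimates for biased bits. -/

/-- Inductive step of the expansion below: one more factor 1 + x raises the slope d by one. The
condition (t + 1)|x| ≤ 1 absorbs the cubic error term. -/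
theorem abs_mul_one_add_sub_le {g d t x : ℝ} (ht : 0 ≤ t) (hd : |d| ≤ t)
    (hx : (t + 1) * |x| ≤ 1) (h : |g - 1 - d * x| ≤ (t * x) ^ 2) :
    |g * (1 + x) - 1 - (d + 1) * x| ≤ ((t + 1) * x) ^ 2 := by
  have e : g * (1 + x) - 1 - (d + 1) * x = (g - 1 - d * x) * (1 + x) + d * x ^ 2 := by ring
  rw [e]
  have hx0 := abs_nonneg x
  have h1 : |1 + x| ≤ 1 + |x| := (abs_add_le _ _).trans (by simp)
  have h2 : |(g - 1 - d * x) * (1 + x)| ≤ (t * x) ^ 2 * (1 + |x|) := by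
    rw [abs_mul]; exact mul_le_mul h h1 (abs_nonneg _) (sq_nonneg _)
  have h3 : |d * x ^ 2| ≤ t * x ^ 2 := by
    rw [abs_mul, abs_of_nonneg (sq_nonneg x)]; exact mul_le_mul_of_nonneg_right hd (sq_nonneg _)
  refine (abs_add_le _ _).trans ((add_le_add h2 h3).trans ?_)
  have h4 : t * |x| ≤ 1 := by nlinarith
  have h5 : t * x ^ 2 * (t * |x|) ≤ t * x ^ 2 * 1 :=
    mul_le_mul_of_nonneg_left h4 (by positivity)
  nlinarith [sq_nonneg x, mul_nonneg ht (sq_nonneg x)]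

/-- First-order expansion of `(1 + x)ᵃ (1 - x)ᵇ`. -/
theorem abs_pow_mul_pow_sub_le (x : ℝ) (a b : ℕ) (h : ((a : ℝ) + b) * |x| ≤ 1) :
    |(1 + x) ^ a * (1 - x) ^ b - 1 - ((a : ℝ) - b) * x| ≤ (((a : ℝ) + b) * x) ^ 2 := by
  induction a with
  | zero =>
    induction b with
    | zero => simp
    | succ b ih =>
      have := abs_mul_one_add_sub_le (g := (1 - x) ^ b) (d := b) (t := b) (x := -x) (by positivity)
        (by simp) (by simpa [abs_neg] using h)
        (by
          have := ih (le_trans (by push_cast; gcongr; simp) h)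
          simpa [mul_pow] using this)
      refine le_trans (le_of_eq ?_) (this.trans (le_of_eq ?_))
      · congr 1; push_cast; ring
      · push_cast; ring
  | succ a ih =>
    have := abs_mul_one_add_sub_le (g := (1 + x) ^ a * (1 - x) ^ b) (d := (a : ℝ) - b)
      (t := (a : ℝ) + b) (x := x) (by positivity)
      (by rw [abs_le]; constructor <;> linarith [(Nat.cast_nonneg a : (0 : ℝ) ≤ a),
            (Nat.cast_nonneg b : (0 : ℝ) ≤ b)])
      (by push_cast at h; linarith [h])
      (ih (le_trans (by push_cast; gcongr; simp) h))
    refine le_trans (le_of_eq ?_) (this.trans (le_of_eq ?_))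
    · congr 1; push_cast; ring
    · push_cast; ring

/-- Difference p and sum q evolve by p ↦ p + x q and q ↦ q + x p, so p / q grows by at most x per
step. -/
theorem pow_sub_pow_le_mul_add {x : ℝ} (h0 : 0 ≤ x) (h1 : x ≤ 1) (d : ℕ) :
    0 ≤ (1 + x) ^ d - (1 - x) ^ d ∧
      (1 + x) ^ d - (1 - x) ^ d ≤ d * x * ((1 + x) ^ d + (1 - x) ^ d) := by
  induction d with
  | zero => simp
  | succ d ih =>
    obtain ⟨ih0, ih1⟩ := ih
    have e1 : (1 + x) ^ (d + 1) - (1 - x) ^ (d + 1) =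
        ((1 + x) ^ d - (1 - x) ^ d) + x * ((1 + x) ^ d + (1 - x) ^ d) := by ring
    have e2 : (1 + x) ^ (d + 1) + (1 - x) ^ (d + 1) =
        ((1 + x) ^ d + (1 - x) ^ d) + x * ((1 + x) ^ d - (1 - x) ^ d) := by ring
    have hs : 0 ≤ (1 + x) ^ d + (1 - x) ^ d :=
      add_nonneg (pow_nonneg (by linarith) _) (pow_nonneg (by linarith) _)
    rw [e1, e2]
    push_cast
    have p1 := mul_nonneg h0 hs
    have p2 := mul_nonneg h0 ih0
    have p3 : 0 ≤ ((d : ℝ) + 1) * x * (x * ((1 + x) ^ d - (1 - x) ^ d)) := by positivity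
    constructor
    · linarith
    · nlinarith

/-- The common factor (1 − x²)^min(a, b) splits off: means x and −x are told apart only through the
imbalance |a − b|. -/
theorem abs_pow_mul_pow_sub_swap_le {x : ℝ} (h0 : 0 ≤ x) (h1 : x ≤ 1) (a b : ℕ) :
    |(1 + x) ^ a * (1 - x) ^ b - (1 - x) ^ a * (1 + x) ^ b| ≤
      |(a : ℝ) - b| * x * ((1 + x) ^ a * (1 - x) ^ b + (1 - x) ^ a * (1 + x) ^ b) := by
  wlog hab : b ≤ a generalizing a b
  · have := this b a (by omega)
    rw [abs_sub_comm, abs_sub_comm (a : ℝ), add_comm]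
    convert this using 2 <;> ring_nf
  obtain ⟨d, rfl⟩ := Nat.exists_eq_add_of_le hab
  obtain ⟨q0, q1⟩ := pow_sub_pow_le_mul_add h0 h1 d
  have hc : 0 ≤ (1 + x) ^ b * (1 - x) ^ b :=
    mul_nonneg (pow_nonneg (by linarith) _) (pow_nonneg (by linarith) _)
  have e1 : (1 + x) ^ (b + d) * (1 - x) ^ b - (1 - x) ^ (b + d) * (1 + x) ^ b =
      (1 + x) ^ b * (1 - x) ^ b * ((1 + x) ^ d - (1 - x) ^ d) := by ring
  have e2 : (1 + x) ^ (b + d) * (1 - x) ^ b + (1 - x) ^ (b + d) * (1 + x) ^ b =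
      (1 + x) ^ b * (1 - x) ^ b * ((1 + x) ^ d + (1 - x) ^ d) := by ring
  have e3 : |((b + d : ℕ) : ℝ) - b| = d := by push_cast; rw [add_sub_cancel_left]; simp
  rw [e1, e2, e3, abs_of_nonneg (mul_nonneg hc q0)]
  nlinarith [mul_le_mul_of_nonneg_left q1 hc]

/-! ### Positions with roles, and the product measures on them. -/

/-- The three kinds of input positions. -/
inductive Role
  | flag
  | payload
  | vote
  deriving DecidableEq

/-- The number of positions with role `k` at which `u` is known to be `b`. -/
def count {n : ℕ} (role : Fin n → Role) (k : Role) (b : Bool) (u : Fin n → Option Bool) : ℕ :=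
  (Finset.univ.filter fun i => role i = k ∧ u i = some b).card

/-- The number of positions with role `k`. -/
def size {n : ℕ} (role : Fin n → Role) (k : Role) : ℕ :=
  (Finset.univ.filter fun i => role i = k).card

/-- The number of known positions. -/
def known {n : ℕ} (role : Fin n → Role) (u : Fin n → Option Bool) : ℕ :=
  count role .vote true u + count role .vote false u + (count role .flag true u +
    count role .flag false u) + (count role .payload true u + count role .payload false u)

theorem count_reveal {n : ℕ} (role : Fin n → Role) (k : Role) (b c : Bool)
    {u : Fin n → Option Bool} {i : Fin n} (hi : u i = none) :
    count role k b (reveal u i c) = count role k b u + if role i = k ∧ c = b then 1 else 0 := by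
  unfold count
  by_cases h : role i = k ∧ c = b
  · rw [if_pos h]
    have : (Finset.univ.filter fun j => role j = k ∧ reveal u i c j = some b) =
        insert i (Finset.univ.filter fun j => role j = k ∧ u j = some b) := by
      ext j
      simp only [Finset.mem_insert, Finset.mem_filter, Finset.mem_univ, true_and]
      by_cases hj : j = i
      · subst hj; simp [reveal, h.1, h.2]
      · simp [reveal, hj]
    rw [this, Finset.card_insert_of_notMem (by simp [hi])]
  · rw [if_neg h, add_zero]
    congr 1
    ext j
    simp only [Finset.mem_filter, Finset.mem_univ, true_and]
    by_cases hj : j = i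
    · subst hj; simpa [reveal, hi] using h
    · simp [reveal, hj]

theorem count_add_count_le {n : ℕ} (role : Fin n → Role) (k : Role) (u : Fin n → Option Bool) :
    count role k true u + count role k false u ≤ size role k := by
  unfold count size
  rw [← Finset.card_union_of_disjoint]
  · refine Finset.card_le_card fun i => ?_
    simp only [Finset.mem_union, Finset.mem_filter, Finset.mem_univ, true_and]
    tauto
  · rw [Finset.disjoint_filter]
    intro i _ h1 h2
    simp [h1.2] at h2

theorem count_add_count_lt {n : ℕ} (role : Fin n → Role) {u : Fin n → Option Bool} {i : Fin n}
    (hi : u i = none) :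
    count role (role i) true u + count role (role i) false u < size role (role i) := by
  have := count_add_count_le role (role i) (reveal u i true)
  rw [count_reveal role _ _ _ hi, count_reveal role _ _ _ hi] at this
  simp at this
  omega

theorem count_full_add {n : ℕ} (role : Fin n → Role) (k : Role) (x : Fin n → Bool) :
    count role k true (full x) + count role k false (full x) = size role k := by
  unfold count size
  rw [← Finset.card_union_of_disjoint]
  · congr 1
    ext i
    simp only [Finset.mem_union, Finset.mem_filter, Finset.mem_univ, true_and, full]
    cases hx : x i <;> simp [hx]
  · rw [Finset.disjoint_filter]
    intro i _ h1 h2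
    simp [h1.2] at h2

theorem known_reveal {n : ℕ} (role : Fin n → Role) (u : Fin n → Option Bool) (i : Fin n)
    (b : Bool) (hi : u i = none) : known role (reveal u i b) = known role u + 1 := by
  unfold known
  simp only [count_reveal role _ _ _ hi]
  cases b <;> cases hr : role i <;> simp <;> ring

/-- Number of ones minus number of zeros among the known votes. -/
noncomputable def lead {n : ℕ} (role : Fin n → Role) (u : Fin n → Option Bool) : ℝ :=
  (count role .vote true u : ℝ) - count role .vote false u

/-- The number of known votes. -/
noncomputable def votes {n : ℕ} (role : Fin n → Role) (u : Fin n → Option Bool) : ℝ :=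
  (count role .vote true u : ℝ) + count role .vote false u

/-- The probability of the partial input `u` when votes are independent with mean `y`, payload
bits are uniform, and the flags have the marginals `F` (zeros seen, ones seen). -/
noncomputable def world {n : ℕ} (role : Fin n → Role) (y : ℝ) (F : ℕ → ℕ → ℝ) (u : Fin n → Option Bool) : ℝ :=
  ((1 + y) / 2) ^ count role .vote true u * ((1 - y) / 2) ^ count role .vote false u *
    (1 / 2) ^ (count role .payload true u + count role .payload false u) *
    F (count role .flag false u) (count role .flag true u)

/-- Consistency of flag marginals. -/
def FlagAdditive (F : ℕ → ℕ → ℝ) : Prop := ∀ z l, F (z + 1) l + F z (l + 1) = F z l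

theorem world_reveal_add {n : ℕ} (role : Fin n → Role) (y : ℝ) {F : ℕ → ℕ → ℝ}
    (hF : FlagAdditive F) (u : Fin n → Option Bool) (i : Fin n) (hi : u i = none) :
    world role y F (reveal u i false) + world role y F (reveal u i true) = world role y F u := by
  unfold world
  simp only [count_reveal role _ _ _ hi]
  cases hr : role i
  · simp
    rw [← hF (count role .flag false u) (count role .flag true u)]
    ring
  · simp; ring
  · simp; ring

theorem world_nonneg {n : ℕ} (role : Fin n → Role) {y : ℝ} (hy : |y| ≤ 1) {F : ℕ → ℕ → ℝ}
    (u : Fin n → Option Bool) (hF : 0 ≤ F (count role .flag false u) (count role .flag true u)) :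
    0 ≤ world role y F u := by
  rw [abs_le] at hy
  unfold world
  have h1 : 0 ≤ (1 + y) / 2 := by linarith
  have h2 : 0 ≤ (1 - y) / 2 := by linarith
  positivity

/-- The squared deviation of the lead from its mean grows by at most one per query. -/
theorem world_mul_sq_reveal_le {n : ℕ} (role : Fin n → Role) {y : ℝ} (hy : |y| ≤ 1)
    {F : ℕ → ℕ → ℝ} (hF : FlagAdditive F) (u : Fin n → Option Bool) (i : Fin n) (hi : u i = none)
    (h0 : 0 ≤ F (count role .flag false u) (count role .flag true u)) :
    world role y F (reveal u i false) *
        (lead role (reveal u i false) - y * votes role (reveal u i false)) ^ 2 +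
      world role y F (reveal u i true) *
        (lead role (reveal u i true) - y * votes role (reveal u i true)) ^ 2 ≤
      world role y F u * (lead role u - y * votes role u) ^ 2 +
        world role y F u * (if role i = .vote then 1 else 0) := by
  have hw := world_nonneg role hy u h0
  have ha := world_reveal_add role y hF u i hi
  cases hr : role i
  · have e : ∀ b, lead role (reveal u i b) = lead role u ∧
        votes role (reveal u i b) = votes role u := by
      intro b; simp [lead, votes, count_reveal role _ _ _ hi, hr]
    rw [(e _).1, (e _).2, (e _).1, (e _).2, ← add_mul, ha]
    simp
  · have e : ∀ b, lead role (reveal u i b) = lead role u ∧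
        votes role (reveal u i b) = votes role u := by
      intro b; simp [lead, votes, count_reveal role _ _ _ hi, hr]
    rw [(e _).1, (e _).2, (e _).1, (e _).2, ← add_mul, ha]
    simp
  · have w0 : world role y F (reveal u i false) = world role y F u * ((1 - y) / 2) := by
      simp [world, count_reveal role _ _ _ hi, hr]; ring
    have w1 : world role y F (reveal u i true) = world role y F u * ((1 + y) / 2) := by
      simp [world, count_reveal role _ _ _ hi, hr]; ring
    have l0 : lead role (reveal u i false) - y * votes role (reveal u i false) =
        lead role u - y * votes role u - 1 - y := by
      simp [lead, votes, count_reveal role _ _ _ hi, hr]; ring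
    have l1 : lead role (reveal u i true) - y * votes role (reveal u i true) =
        lead role u - y * votes role u + 1 - y := by
      simp [lead, votes, count_reveal role _ _ _ hi, hr]; ring
    -- A vote has mean y, so the cross terms cancel and the growth is its variance 1 − y² times the
    -- weight.
    rw [w0, w1, l0, l1]
    generalize lead role u - y * votes role u = D
    simp only [if_true]
    nlinarith [mul_nonneg hw (sq_nonneg y)]

/-- Chebyshev's inequality for the lead. -/
theorem sum_world_mul_sq_le {n : ℕ} (role : Fin n → Role) {y : ℝ} (hy : |y| ≤ 1)
    {F : ℕ → ℕ → ℝ} (hF : FlagAdditive F)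
    (h0 : ∀ u : Fin n → Option Bool, 0 ≤ F (count role .flag false u) (count role .flag true u))
    (hF1 : F 0 0 = 1) :
    ∑ x : Fin n → Bool, world role y F (full x) *
      (lead role (full x) - y * size role .vote) ^ 2 ≤ size role .vote := by
  -- Each vote raises the first term by at most the weight and the second by exactly the weight, so
  -- the difference does not increase.
  have key := sum_full_le
    (fun u => world role y F u * (lead role u - y * votes role u) ^ 2 -
      world role y F u * votes role u) (fun u i hi => ?_) (fun _ : Fin n => none)
  · rw [cylinder_none] at key
    have e0 : world role y F (fun _ : Fin n => none) = 1 := by simp [world, count, hF1]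
    have e1 : lead role (fun _ : Fin n => none) = 0 := by simp [lead, count]
    have e2 : votes role (fun _ : Fin n => none) = 0 := by simp [votes, count]
    have e3 : ∀ x : Fin n → Bool, votes role (full x) = size role .vote := by
      intro x; unfold votes; exact_mod_cast count_full_add role .vote x
    have e4 := sum_full_eq _ (world_reveal_add role y hF) (fun _ : Fin n => none)
    rw [cylinder_none, e0] at e4
    simp only [e1, e2, e3, Finset.sum_sub_distrib, ← Finset.sum_mul, e4] at key
    linarith
  · have h1 := world_mul_sq_reveal_le role hy hF u i hi (h0 u)
    have h2 := world_reveal_add role y hF u i hi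
    have e : ∀ b, votes role (reveal u i b) =
        votes role u + if role i = .vote then 1 else 0 := by
      intro b
      cases b <;> cases hr : role i <;> simp [votes, count_reveal role _ _ _ hi, hr] <;> ring
    simp only [e] at h1 ⊢
    rw [← h2] at h1 ⊢
    linarith

/-! ### The hard measure and the potential. -/

/-- Marginals of the flags when no flag is set. -/
noncomputable def noFlag (_ l : ℕ) : ℝ := if l = 0 then 1 else 0

/-- Marginals of the flags when one uniformly random flag out of `r²` is set. -/
noncomputable def oneFlag (r : ℕ) (z l : ℕ) : ℝ :=
  if l = 0 then 1 - z / (r : ℝ) ^ 2 else if l = 1 then 1 / (r : ℝ) ^ 2 else 0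

theorem flagAdditive_noFlag : FlagAdditive noFlag := by
  intro z l; cases l <;> simp [noFlag]

theorem flagAdditive_oneFlag (r : ℕ) : FlagAdditive (oneFlag r) := by
  intro z l
  rcases l with _ | _ | l
  · simp [oneFlag]; ring
  · simp [oneFlag]
  · simp [oneFlag]

theorem noFlag_nonneg (z l : ℕ) : 0 ≤ noFlag z l := by unfold noFlag; split <;> norm_num

theorem oneFlag_nonneg {r z : ℕ} (hr : 0 < r) (hz : z ≤ r ^ 2) (l : ℕ) : 0 ≤ oneFlag r z l := by
  have hr' : (0 : ℝ) < (r : ℝ) ^ 2 := by positivity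
  unfold oneFlag
  split
  · rw [sub_nonneg, div_le_one hr']; exact_mod_cast hz
  · split <;> positivity

/-- The layout of the input: `r²` flags and `r⁴` payload bits, the rest being votes. -/
structure Layout (n r : ℕ) where
  role : Fin n → Role
  size_flag : size role .flag = r ^ 2
  size_payload : size role .payload = r ^ 4

namespace Layout

variable {n r : ℕ} (Λ : Layout n r)

/-- No flag is set and votes have mean `s / r⁴`. -/
noncomputable def plain (s : ℝ) : (Fin n → Option Bool) → ℝ :=
  world Λ.role (s / (r : ℝ) ^ 4) noFlag

/-- A random flag is set and votes have mean `-s / r³`. -/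
noncomputable def flagged (s : ℝ) : (Fin n → Option Bool) → ℝ :=
  world Λ.role (-s / (r : ℝ) ^ 3) (oneFlag r)

/-- The sign of the payload's parity if the payload is known, and `0` otherwise. -/
noncomputable def parity (u : Fin n → Option Bool) : ℝ :=
  if count Λ.role .payload true u + count Λ.role .payload false u = r ^ 4 then
    (-1) ^ count Λ.role .payload true u else 0

/-- The signed hard measure: positive on `1`-inputs, negative on `0`-inputs. -/
noncomputable def signed (u : Fin n → Option Bool) : ℝ :=
  (Λ.plain 1 u - Λ.plain (-1) u) + 1 / r * (Λ.flagged 1 u - Λ.flagged (-1) u +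
    (Λ.flagged 1 u + Λ.flagged (-1) u) * Λ.parity u)

noncomputable def plainMass (u : Fin n → Option Bool) : ℝ := Λ.plain 1 u + Λ.plain (-1) u

noncomputable def flaggedMass (u : Fin n → Option Bool) : ℝ := Λ.flagged 1 u + Λ.flagged (-1) u

noncomputable def mass (u : Fin n → Option Bool) : ℝ := Λ.plainMass u + Λ.flaggedMass u

/-- Each world is centred at its own expected lead: this second moment grows by at most the mass per
query, whereas the raw square of the lead would also drift. -/
noncomputable def plainVar (u : Fin n → Option Bool) : ℝ :=
  Λ.plain 1 u * (lead Λ.role u - 1 / (r : ℝ) ^ 4 * votes Λ.role u) ^ 2 +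
    Λ.plain (-1) u * (lead Λ.role u - -1 / (r : ℝ) ^ 4 * votes Λ.role u) ^ 2

noncomputable def flaggedVar (u : Fin n → Option Bool) : ℝ :=
  Λ.flagged 1 u * (lead Λ.role u - -1 / (r : ℝ) ^ 3 * votes Λ.role u) ^ 2 +
    Λ.flagged (-1) u * (lead Λ.role u - - -1 / (r : ℝ) ^ 3 * votes Λ.role u) ^ 2

/-- A penalty for finding a set flag early. -/
noncomputable def found (u : Fin n → Option Bool) : ℝ :=
  if 1 ≤ count Λ.role .flag true u ∧ known Λ.role u ≤ r ^ 2 then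
    (r : ℝ) ^ 2 * Λ.flaggedMass u else 0

/-- The potential that dominates the signed measure. -/
noncomputable def potential (u : Fin n → Option Bool) : ℝ :=
  if known Λ.role u ≤ r ^ 6 then
    1 / (r : ℝ) ^ 5 * (8 * (known Λ.role u * Λ.mass u) +
      2 * (Λ.plainVar u + Λ.flaggedVar u) + Λ.found u)
  else 2 * Λ.mass u

/-! ### Nonnegativity and additivity of the measures. -/

section basic

theorem abs_div_pow_le {s : ℝ} (hs : |s| ≤ 1) (hr : 2 ≤ r) {k : ℕ} :
    |s / (r : ℝ) ^ k| ≤ 1 := by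
  have h1 : (1 : ℝ) ≤ r := by exact_mod_cast (by omega : 1 ≤ r)
  rw [abs_div, abs_of_nonneg (by positivity : (0 : ℝ) ≤ (r : ℝ) ^ k)]
  exact div_le_one_of_le₀ (hs.trans (one_le_pow₀ h1)) (by positivity)

theorem zeros_le (u : Fin n → Option Bool) : count Λ.role .flag false u ≤ r ^ 2 := by
  have := count_add_count_le Λ.role .flag u
  rw [Λ.size_flag] at this
  omega

theorem oneFlag_count_nonneg (hr : 2 ≤ r) (u : Fin n → Option Bool) :
    0 ≤ oneFlag r (count Λ.role .flag false u) (count Λ.role .flag true u) :=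
  oneFlag_nonneg (by omega) (Λ.zeros_le u) _

theorem plain_nonneg (hr : 2 ≤ r) {s : ℝ} (hs : |s| ≤ 1) (u : Fin n → Option Bool) :
    0 ≤ Λ.plain s u :=
  world_nonneg _ (abs_div_pow_le hs hr) _ (noFlag_nonneg _ _)

theorem flagged_nonneg (hr : 2 ≤ r) {s : ℝ} (hs : |s| ≤ 1) (u : Fin n → Option Bool) :
    0 ≤ Λ.flagged s u :=
  world_nonneg _ (abs_div_pow_le (by rwa [abs_neg]) hr) _
    (Λ.oneFlag_count_nonneg hr u)

theorem plainMass_nonneg (hr : 2 ≤ r) (u : Fin n → Option Bool) : 0 ≤ Λ.plainMass u :=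
  add_nonneg (Λ.plain_nonneg hr (by norm_num) u) (Λ.plain_nonneg hr (by norm_num) u)

theorem flaggedMass_nonneg (hr : 2 ≤ r) (u : Fin n → Option Bool) : 0 ≤ Λ.flaggedMass u :=
  add_nonneg (Λ.flagged_nonneg hr (by norm_num) u) (Λ.flagged_nonneg hr (by norm_num) u)

theorem mass_nonneg (hr : 2 ≤ r) (u : Fin n → Option Bool) : 0 ≤ Λ.mass u :=
  add_nonneg (Λ.plainMass_nonneg hr u) (Λ.flaggedMass_nonneg hr u)

theorem plainVar_nonneg (hr : 2 ≤ r) (u : Fin n → Option Bool) : 0 ≤ Λ.plainVar u :=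
  add_nonneg (mul_nonneg (Λ.plain_nonneg hr (by norm_num) u) (sq_nonneg _))
    (mul_nonneg (Λ.plain_nonneg hr (by norm_num) u) (sq_nonneg _))

theorem flaggedVar_nonneg (hr : 2 ≤ r) (u : Fin n → Option Bool) : 0 ≤ Λ.flaggedVar u :=
  add_nonneg (mul_nonneg (Λ.flagged_nonneg hr (by norm_num) u) (sq_nonneg _))
    (mul_nonneg (Λ.flagged_nonneg hr (by norm_num) u) (sq_nonneg _))

theorem found_nonneg (hr : 2 ≤ r) (u : Fin n → Option Bool) : 0 ≤ Λ.found u := by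
  unfold found
  have := Λ.flaggedMass_nonneg hr u
  split <;> positivity

end basic

section additive

variable {u : Fin n → Option Bool} {i : Fin n}

theorem plain_reveal_add (s : ℝ) (hi : u i = none) :
    Λ.plain s (reveal u i false) + Λ.plain s (reveal u i true) = Λ.plain s u :=
  world_reveal_add _ _ flagAdditive_noFlag _ _ hi

theorem flagged_reveal_add (s : ℝ) (hi : u i = none) :
    Λ.flagged s (reveal u i false) + Λ.flagged s (reveal u i true) = Λ.flagged s u :=
  world_reveal_add _ _ (flagAdditive_oneFlag r) _ _ hi

theorem mass_reveal_add (hi : u i = none) :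
    Λ.mass (reveal u i false) + Λ.mass (reveal u i true) = Λ.mass u := by
  unfold mass plainMass flaggedMass
  rw [← Λ.plain_reveal_add 1 hi, ← Λ.plain_reveal_add (-1) hi, ← Λ.flagged_reveal_add 1 hi,
    ← Λ.flagged_reveal_add (-1) hi]
  ring

/-- The two values of the last unknown payload bit have equal weight and opposite parity; until then
the parity counts as 0. -/
theorem flagged_mul_parity_reveal_add (s : ℝ) (hi : u i = none) :
    Λ.flagged s (reveal u i false) * Λ.parity (reveal u i false) +
      Λ.flagged s (reveal u i true) * Λ.parity (reveal u i true) =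
      Λ.flagged s u * Λ.parity u := by
  have hadd := Λ.flagged_reveal_add s hi
  by_cases hr : Λ.role i = .payload
  · have hlt := count_add_count_lt Λ.role hi
    rw [hr, Λ.size_payload] at hlt
    have e : Λ.flagged s (reveal u i false) = Λ.flagged s (reveal u i true) := by
      simp only [flagged, world, count_reveal Λ.role _ _ _ hi, hr]
      simp
      left; left
      ring
    rw [e, ← mul_add]
    have e0 : Λ.parity u = 0 := by unfold parity; rw [if_neg hlt.ne]
    rw [e0, mul_zero]
    have : Λ.parity (reveal u i false) + Λ.parity (reveal u i true) = 0 := by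
      have ht : ∀ b, count Λ.role .payload true (reveal u i b) =
          count Λ.role .payload true u + if b = true then 1 else 0 := by
        intro b; rw [count_reveal Λ.role _ _ _ hi]; simp [hr]
      have hf : ∀ b, count Λ.role .payload false (reveal u i b) =
          count Λ.role .payload false u + if b = false then 1 else 0 := by
        intro b; rw [count_reveal Λ.role _ _ _ hi]; simp [hr]
      simp only [parity, ht, hf, reduceCtorEq, if_false, if_true, add_zero]
      rw [add_right_comm, ← add_assoc]
      split
      · ring
      · simp
    rw [this, mul_zero]
  · have e : ∀ b, Λ.parity (reveal u i b) = Λ.parity u := by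
      intro b; simp [parity, count_reveal Λ.role _ _ _ hi, hr]
    rw [e, e, ← add_mul, hadd]

theorem signed_reveal_add (hi : u i = none) :
    Λ.signed (reveal u i false) + Λ.signed (reveal u i true) = Λ.signed u := by
  have h1 := Λ.plain_reveal_add 1 hi
  have h2 := Λ.plain_reveal_add (-1) hi
  have h3 := Λ.flagged_reveal_add 1 hi
  have h4 := Λ.flagged_reveal_add (-1) hi
  have h5 := Λ.flagged_mul_parity_reveal_add 1 hi
  have h6 := Λ.flagged_mul_parity_reveal_add (-1) hi
  unfold signed
  linear_combination h1 - h2 + 1 / (r : ℝ) * (h3 - h4 + h5 + h6)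

theorem plainVar_add_flaggedVar_reveal_le (hr : 2 ≤ r) (hi : u i = none) :
    Λ.plainVar (reveal u i false) + Λ.flaggedVar (reveal u i false) +
      (Λ.plainVar (reveal u i true) + Λ.flaggedVar (reveal u i true)) ≤
      Λ.plainVar u + Λ.flaggedVar u + Λ.mass u := by
  have key : ∀ {y : ℝ} {F : ℕ → ℕ → ℝ}, |y| ≤ 1 → FlagAdditive F →
      0 ≤ F (count Λ.role .flag false u) (count Λ.role .flag true u) →
      world Λ.role y F (reveal u i false) *
        (lead Λ.role (reveal u i false) - y * votes Λ.role (reveal u i false)) ^ 2 +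
      world Λ.role y F (reveal u i true) *
        (lead Λ.role (reveal u i true) - y * votes Λ.role (reveal u i true)) ^ 2 ≤
      world Λ.role y F u * (lead Λ.role u - y * votes Λ.role u) ^ 2 + world Λ.role y F u := by
    intro y F hy hF h0
    refine (world_mul_sq_reveal_le Λ.role hy hF u i hi h0).trans ?_
    have := world_nonneg Λ.role hy u h0
    split <;> linarith
  have h1 := key (abs_div_pow_le (s := 1) (r := r) (k := 4) (by norm_num) hr)
    flagAdditive_noFlag (noFlag_nonneg _ _)
  have h2 := key (abs_div_pow_le (s := -1) (r := r) (k := 4) (by norm_num) hr)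
    flagAdditive_noFlag (noFlag_nonneg _ _)
  have h3 := key (abs_div_pow_le (s := -1) (r := r) (k := 3) (by norm_num) hr)
    (flagAdditive_oneFlag r) (Λ.oneFlag_count_nonneg hr u)
  have h4 := key (abs_div_pow_le (s := - -1) (r := r) (k := 3) (by norm_num) hr)
    (flagAdditive_oneFlag r) (Λ.oneFlag_count_nonneg hr u)
  unfold plainVar flaggedVar mass plainMass flaggedMass plain flagged
  linarith

end additive

/-! ### The potential dominates the signed measure. -/

section bounds

/-- The weight of the known votes and payload bits when they are uniform. -/
noncomputable def base (u : Fin n → Option Bool) : ℝ :=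
  (1 / 2) ^ (count Λ.role .vote true u + count Λ.role .vote false u) *
    (1 / 2) ^ (count Λ.role .payload true u + count Λ.role .payload false u)

theorem base_nonneg (u : Fin n → Option Bool) : 0 ≤ Λ.base u := by unfold base; positivity

/-- Separates the uniform weight from the likelihood ratio of the votes, the only factor that
depends on y. -/
theorem world_eq (y : ℝ) (F : ℕ → ℕ → ℝ) (u : Fin n → Option Bool) :
    world Λ.role y F u = Λ.base u * ((1 + y) ^ count Λ.role .vote true u *
      (1 - y) ^ count Λ.role .vote false u) *
      F (count Λ.role .flag false u) (count Λ.role .flag true u) := by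
  unfold world base
  simp only [div_pow, one_pow, pow_add]
  field_simp

theorem votes_le_known (u : Fin n → Option Bool) : votes Λ.role u ≤ known Λ.role u := by
  unfold votes known
  push_cast
  have h1 : (0 : ℝ) ≤ count Λ.role .flag true u := by positivity
  have h2 : (0 : ℝ) ≤ count Λ.role .flag false u := by positivity
  have h3 : (0 : ℝ) ≤ count Λ.role .payload true u := by positivity
  have h4 : (0 : ℝ) ≤ count Λ.role .payload false u := by positivity
  linarith

theorem votes_nonneg (u : Fin n → Option Bool) : 0 ≤ votes Λ.role u := by
  unfold votes; positivity

theorem abs_world_sub_le {x : ℝ} (h0 : 0 ≤ x) (h1 : x ≤ 1) {F : ℕ → ℕ → ℝ}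
    (u : Fin n → Option Bool)
    (hF : 0 ≤ F (count Λ.role .flag false u) (count Λ.role .flag true u)) :
    |world Λ.role x F u - world Λ.role (-x) F u| ≤
      |lead Λ.role u| * x * (world Λ.role x F u + world Λ.role (-x) F u) := by
  have := abs_pow_mul_pow_sub_swap_le h0 h1 (count Λ.role .vote true u)
    (count Λ.role .vote false u)
  rw [world_eq, world_eq, sub_neg_eq_add, ← sub_eq_add_neg]
  have hb := mul_nonneg (Λ.base_nonneg u) hF
  have h2 := mul_le_mul_of_nonneg_left this hb
  unfold lead
  generalize F (count Λ.role .flag false u) (count Λ.role .flag true u) = c at *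
  have e : ∀ p q p' q' : ℝ, Λ.base u * (p * q) * c - Λ.base u * (p' * q') * c =
      Λ.base u * c * (p * q - p' * q') := fun _ _ _ _ => by ring
  rw [e, abs_mul, abs_of_nonneg hb]
  exact h2.trans_eq (by ring)

theorem abs_plain_sub_le (hr : 2 ≤ r) (u : Fin n → Option Bool) :
    |Λ.plain 1 u - Λ.plain (-1) u| ≤ |lead Λ.role u| * (1 / (r : ℝ) ^ 4) * Λ.plainMass u := by
  have hx : |(1 : ℝ) / (r : ℝ) ^ 4| ≤ 1 := abs_div_pow_le (by norm_num) hr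
  unfold plainMass plain
  rw [neg_div]
  exact Λ.abs_world_sub_le (by positivity) (abs_le.mp hx).2 u (noFlag_nonneg _ _)

theorem abs_flagged_sub_le (hr : 2 ≤ r) (u : Fin n → Option Bool) :
    |Λ.flagged 1 u - Λ.flagged (-1) u| ≤
      |lead Λ.role u| * (1 / (r : ℝ) ^ 3) * Λ.flaggedMass u := by
  have hx : |(1 : ℝ) / (r : ℝ) ^ 3| ≤ 1 := abs_div_pow_le (by norm_num) hr
  unfold flaggedMass flagged
  rw [neg_neg, neg_div, abs_sub_comm, add_comm]
  exact Λ.abs_world_sub_le (by positivity) (abs_le.mp hx).2 u (Λ.oneFlag_count_nonneg hr u)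

/-- This is where the threshold r⁶ originates: a mean of size at most 1/r³ shifts the lead of t
votes by at most t/r³, whose square is at most t when t ≤ r⁶. -/
theorem sq_le_of_abs_le (hr : 2 ≤ r) {u : Fin n → Option Bool} (hu : known Λ.role u ≤ r ^ 6)
    {s : ℝ} (hs : |s| = 1) {k : ℕ} (hk : 3 ≤ k) :
    lead Λ.role u ^ 2 ≤ 2 * (lead Λ.role u - s / (r : ℝ) ^ k * votes Λ.role u) ^ 2 +
      2 * known Λ.role u := by
  have hr1 : (1 : ℝ) ≤ r := by exact_mod_cast (by omega : 1 ≤ r)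
  have hy : (s / (r : ℝ) ^ k) ^ 2 ≤ 1 / (r : ℝ) ^ 6 := by
    rw [div_pow, ← sq_abs, hs, one_pow, ← pow_mul]
    exact one_div_le_one_div_of_le (by positivity) (pow_le_pow_right₀ hr1 (by omega))
  have hv0 := Λ.votes_nonneg u
  have hv := Λ.votes_le_known u
  have ht : (known Λ.role u : ℝ) ≤ (r : ℝ) ^ 6 := by exact_mod_cast hu
  have h1 : votes Λ.role u ^ 2 ≤ (r : ℝ) ^ 6 * known Λ.role u := by
    nlinarith
  have h2 : (s / (r : ℝ) ^ k * votes Λ.role u) ^ 2 ≤ known Λ.role u := by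
    rw [mul_pow]
    calc _ ≤ 1 / (r : ℝ) ^ 6 * ((r : ℝ) ^ 6 * known Λ.role u) :=
          mul_le_mul hy h1 (sq_nonneg _) (by positivity)
      _ = _ := by field_simp
  nlinarith [sq_nonneg (lead Λ.role u - 2 * (s / (r : ℝ) ^ k * votes Λ.role u))]

theorem plainMass_mul_sq_le (hr : 2 ≤ r) {u : Fin n → Option Bool}
    (hu : known Λ.role u ≤ r ^ 6) : Λ.plainMass u * lead Λ.role u ^ 2 ≤
      2 * Λ.plainVar u + 2 * (known Λ.role u * Λ.plainMass u) := by
  have h1 := mul_le_mul_of_nonneg_left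
    (Λ.sq_le_of_abs_le hr hu (s := 1) (k := 4) (by norm_num) (by norm_num))
    (Λ.plain_nonneg hr (s := 1) (by norm_num) u)
  have h2 := mul_le_mul_of_nonneg_left
    (Λ.sq_le_of_abs_le hr hu (s := -1) (k := 4) (by norm_num) (by norm_num))
    (Λ.plain_nonneg hr (s := -1) (by norm_num) u)
  unfold plainMass plainVar
  linarith

theorem flaggedMass_mul_sq_le (hr : 2 ≤ r) {u : Fin n → Option Bool}
    (hu : known Λ.role u ≤ r ^ 6) : Λ.flaggedMass u * lead Λ.role u ^ 2 ≤
      2 * Λ.flaggedVar u + 2 * (known Λ.role u * Λ.flaggedMass u) := by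
  have h1 := mul_le_mul_of_nonneg_left
    (Λ.sq_le_of_abs_le hr hu (s := -1) (k := 3) (by norm_num) (by norm_num))
    (Λ.flagged_nonneg hr (s := 1) (by norm_num) u)
  have h2 := mul_le_mul_of_nonneg_left
    (Λ.sq_le_of_abs_le hr hu (s := - -1) (k := 3) (by norm_num) (by norm_num))
    (Λ.flagged_nonneg hr (s := -1) (by norm_num) u)
  unfold flaggedMass flaggedVar
  linarith

/-- A nonzero parity has taken r⁴ queries, so it can be charged to them at rate 1/r⁴ each. -/
theorem abs_parity_le (hr : 2 ≤ r) (u : Fin n → Option Bool) :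
    |Λ.parity u| ≤ known Λ.role u / (r : ℝ) ^ 4 := by
  unfold parity
  split
  · rename_i h
    rw [abs_pow, abs_neg, abs_one, one_pow, one_le_div (by positivity)]
    have : r ^ 4 ≤ known Λ.role u := by unfold known; omega
    exact_mod_cast this
  · rw [abs_zero]; positivity

theorem abs_parity_le_one (u : Fin n → Option Bool) : |Λ.parity u| ≤ 1 := by
  unfold parity
  split
  · simp
  · simp

/-- First-order expansion of the vote likelihood while few votes are known. -/
theorem abs_voteFactor_sub_le {u : Fin n → Option Bool}
    (hu : known Λ.role u ≤ r ^ 2) (hr : 2 ≤ r) {s : ℝ} (hs : |s| = 1) {k : ℕ} (hk : 3 ≤ k) :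
    |(1 + s / (r : ℝ) ^ k) ^ count Λ.role .vote true u *
      (1 - s / (r : ℝ) ^ k) ^ count Λ.role .vote false u - 1 - lead Λ.role u *
        (s / (r : ℝ) ^ k)| ≤ known Λ.role u * ((r : ℝ) ^ 2 / (r : ℝ) ^ (2 * k)) := by
  have hr1 : (1 : ℝ) ≤ r := by exact_mod_cast (by omega : 1 ≤ r)
  have hv0 := Λ.votes_nonneg u
  have hv := Λ.votes_le_known u
  have ht : (known Λ.role u : ℝ) ≤ (r : ℝ) ^ 2 := by exact_mod_cast hu
  have habs : |s / (r : ℝ) ^ k| = 1 / (r : ℝ) ^ k := by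
    rw [abs_div, hs, abs_of_nonneg (by positivity)]
  refine (abs_pow_mul_pow_sub_le (s / (r : ℝ) ^ k) _ _ ?_).trans ?_
  · rw [habs, mul_one_div, div_le_one (by positivity)]
    exact (hv.trans ht).trans (pow_le_pow_right₀ hr1 (by omega))
  · rw [mul_pow, ← sq_abs (s / _), habs]
    have h1 : votes Λ.role u ^ 2 ≤ (r : ℝ) ^ 2 * known Λ.role u := by nlinarith
    calc _ ≤ (r : ℝ) ^ 2 * known Λ.role u * (1 / (r : ℝ) ^ k) ^ 2 :=
          mul_le_mul_of_nonneg_right h1 (sq_nonneg _)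
      _ = _ := by rw [one_div_pow, ← pow_mul, mul_comm k 2]; ring

/-- The plain weight of a partial input without set flags is comparable to its base weight. -/
theorem base_le_plainMass (hr : 2 ≤ r) {u : Fin n → Option Bool} (hu : known Λ.role u ≤ r ^ 2)
    (hl : count Λ.role .flag true u = 0) : Λ.base u ≤ Λ.plainMass u := by
  have hr2 : (2 : ℝ) ≤ r := by exact_mod_cast hr
  have h1 := Λ.abs_voteFactor_sub_le hu hr (s := 1) (k := 4) (by norm_num) (by norm_num)
  have h2 := Λ.abs_voteFactor_sub_le hu hr (s := -1) (k := 4) (by norm_num) (by norm_num)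
  have ht : (known Λ.role u : ℝ) ≤ (r : ℝ) ^ 2 := by exact_mod_cast hu
  have hs : (known Λ.role u : ℝ) * ((r : ℝ) ^ 2 / (r : ℝ) ^ (2 * 4)) ≤ 1 / 2 := by
    calc _ ≤ (r : ℝ) ^ 2 * ((r : ℝ) ^ 2 / (r : ℝ) ^ (2 * 4)) :=
          mul_le_mul_of_nonneg_right ht (by positivity)
      _ = 1 / (r : ℝ) ^ 4 := by field_simp
      _ ≤ 1 / 2 := by
          refine one_div_le_one_div_of_le (by norm_num) ?_
          nlinarith [pow_le_pow_left₀ (by norm_num) hr2 4]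
  have h1' := (abs_le.mp (h1.trans hs)).1
  have h2' := (abs_le.mp (h2.trans hs)).1
  unfold plainMass plain
  rw [world_eq, world_eq]
  simp only [noFlag, hl, if_true, mul_one]
  rw [← mul_add]
  refine le_mul_of_one_le_right (Λ.base_nonneg u) ?_
  rw [neg_div] at h2' ⊢
  linarith

theorem potential_eq {u : Fin n → Option Bool} (h : known Λ.role u ≤ r ^ 6) :
    Λ.potential u = 1 / (r : ℝ) ^ 5 * (8 * (known Λ.role u * Λ.mass u) +
      2 * (Λ.plainVar u + Λ.flaggedVar u) + Λ.found u) := if_pos h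

/-- The correlation without the parity term. -/
theorem abs_signed_le (hr : 2 ≤ r) {u : Fin n → Option Bool} :
    |Λ.signed u| ≤ |(Λ.plain 1 u - Λ.plain (-1) u) + 1 / r * (Λ.flagged 1 u - Λ.flagged (-1) u)| +
      1 / (r : ℝ) ^ 5 * (known Λ.role u * Λ.flaggedMass u) := by
  have hr1 : (0 : ℝ) < r := by exact_mod_cast (by omega : 0 < r)
  have e : Λ.signed u = ((Λ.plain 1 u - Λ.plain (-1) u) +
      1 / r * (Λ.flagged 1 u - Λ.flagged (-1) u)) + 1 / r * (Λ.flaggedMass u * Λ.parity u) := by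
    unfold signed flaggedMass; ring
  rw [e]
  refine (abs_add_le _ _).trans (add_le_add le_rfl ?_)
  have hm := Λ.flaggedMass_nonneg hr u
  rw [abs_mul, abs_mul, abs_of_nonneg hm, abs_of_nonneg (by positivity : (0 : ℝ) ≤ 1 / r)]
  calc _ ≤ 1 / (r : ℝ) * (Λ.flaggedMass u * (known Λ.role u / (r : ℝ) ^ 4)) := by
        gcongr; exact Λ.abs_parity_le hr u
    _ = _ := by field_simp

/-- The elementary inequality `r |d| ≤ (d² + r²) / 2`, scaled. -/
theorem abs_div_le_sq_add_sq {d m : ℝ} (hm : 0 ≤ m) (hr : 2 ≤ r) :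
    |d| * (1 / (r : ℝ) ^ 4) * m ≤ 1 / (r : ℝ) ^ 5 * ((m * d ^ 2 + (r : ℝ) ^ 2 * m) / 2) := by
  have hr1 : (0 : ℝ) < r := by exact_mod_cast (by omega : 0 < r)
  have h : (r : ℝ) * |d| ≤ (d ^ 2 + (r : ℝ) ^ 2) / 2 := by
    nlinarith [sq_nonneg ((r : ℝ) - |d|), sq_abs d]
  calc _ = 1 / (r : ℝ) ^ 5 * ((r * |d|) * m) := by field_simp
    _ ≤ 1 / (r : ℝ) ^ 5 * (((d ^ 2 + (r : ℝ) ^ 2) / 2) * m) := by gcongr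
    _ = _ := by ring

/-- Late phase, without cancellation: by AM–GM |lead|/r⁴ ≤ (lead² + r²)/(2r⁵). The variances and the
number of queries pay for lead², and r² is at most the number of queries. -/
theorem abs_signed_le_of_le_known (hr : 2 ≤ r) {u : Fin n → Option Bool}
    (h2 : r ^ 2 ≤ known Λ.role u) (h6 : known Λ.role u ≤ r ^ 6) :
    |Λ.signed u| ≤ Λ.potential u := by
  have hr1 : (0 : ℝ) < r := by exact_mod_cast (by omega : 0 < r)
  rw [Λ.potential_eq h6]
  refine (Λ.abs_signed_le hr).trans ?_
  have hB := Λ.plainMass_nonneg hr u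
  have hA := Λ.flaggedMass_nonneg hr u
  have ht : (r : ℝ) ^ 2 ≤ known Λ.role u := by exact_mod_cast h2
  have p1 := (Λ.abs_plain_sub_le hr u).trans (abs_div_le_sq_add_sq hB hr)
  have p2 : |1 / r * (Λ.flagged 1 u - Λ.flagged (-1) u)| ≤ 1 / (r : ℝ) ^ 5 *
      ((Λ.flaggedMass u * lead Λ.role u ^ 2 + (r : ℝ) ^ 2 * Λ.flaggedMass u) / 2) := by
    refine le_trans ?_ (abs_div_le_sq_add_sq hA hr)
    rw [abs_mul, abs_of_nonneg (by positivity : (0 : ℝ) ≤ 1 / r)]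
    refine (mul_le_mul_of_nonneg_left (Λ.abs_flagged_sub_le hr u) (by positivity)).trans_eq ?_
    field_simp
  have q1 := Λ.plainMass_mul_sq_le hr h6
  have q2 := Λ.flaggedMass_mul_sq_le hr h6
  refine (add_le_add ((abs_add_le _ _).trans (add_le_add p1 p2)) le_rfl).trans ?_
  rw [← mul_add, ← mul_add]
  refine mul_le_mul_of_nonneg_left ?_ (by positivity)
  have m1 := mul_le_mul_of_nonneg_right ht hB
  have m2 := mul_le_mul_of_nonneg_right ht hA
  have f := Λ.found_nonneg hr u
  have v1 := Λ.plainVar_nonneg hr u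
  have v2 := Λ.flaggedVar_nonneg hr u
  have t0 : (0 : ℝ) ≤ known Λ.role u := by positivity
  have t1 := mul_nonneg t0 hB
  have t2 := mul_nonneg t0 hA
  unfold mass
  rw [mul_add (known Λ.role u : ℝ)]
  linarith

/-- A set flag excludes the plain worlds, so nothing cancels, and the r² of the AM–GM bound is not
yet covered by the number of queries. The term `found` pays for it. -/
theorem abs_signed_le_of_found (hr : 2 ≤ r) {u : Fin n → Option Bool}
    (h2 : known Λ.role u ≤ r ^ 2) (hl : 1 ≤ count Λ.role .flag true u) :
    |Λ.signed u| ≤ Λ.potential u := by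
  have hr1 : (0 : ℝ) < r := by exact_mod_cast (by omega : 0 < r)
  have h6 : known Λ.role u ≤ r ^ 6 := h2.trans (Nat.pow_le_pow_right (by omega) (by norm_num))
  rw [Λ.potential_eq h6]
  refine (Λ.abs_signed_le hr).trans ?_
  have hA := Λ.flaggedMass_nonneg hr u
  have e : ∀ s, Λ.plain s u = 0 := by
    intro s; unfold plain; rw [world_eq]
    rw [noFlag, if_neg (by omega), mul_zero]
  have p2 : |1 / r * (Λ.flagged 1 u - Λ.flagged (-1) u)| ≤ 1 / (r : ℝ) ^ 5 *
      ((Λ.flaggedMass u * lead Λ.role u ^ 2 + (r : ℝ) ^ 2 * Λ.flaggedMass u) / 2) := by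
    refine le_trans ?_ (abs_div_le_sq_add_sq hA hr)
    rw [abs_mul, abs_of_nonneg (by positivity : (0 : ℝ) ≤ 1 / r)]
    refine (mul_le_mul_of_nonneg_left (Λ.abs_flagged_sub_le hr u) (by positivity)).trans_eq ?_
    field_simp
  rw [e, e, sub_self, zero_add]
  refine (add_le_add p2 le_rfl).trans ?_
  rw [← mul_add]
  refine mul_le_mul_of_nonneg_left ?_ (by positivity)
  have q2 := Λ.flaggedMass_mul_sq_le hr h6
  have hB := Λ.plainMass_nonneg hr u
  have v1 := Λ.plainVar_nonneg hr u
  have v2 := Λ.flaggedVar_nonneg hr u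
  have t0 : (0 : ℝ) ≤ known Λ.role u := by positivity
  have t1 := mul_nonneg t0 hB
  have t2 := mul_nonneg t0 hA
  have t3 : 0 ≤ (r : ℝ) ^ 2 * Λ.flaggedMass u := by positivity
  unfold mass found
  rw [if_pos ⟨hl, h2⟩, mul_add (known Λ.role u : ℝ)]
  linarith

/-- The case that needs the balance 1/r⁴ = (1/r)(1/r³): the first-order vote terms of the plain and
flagged worlds cancel, up to the factor 1 − z/r² left by z flags known to be zero. -/
theorem abs_signed_le_of_not_found (hr : 2 ≤ r) {u : Fin n → Option Bool}
    (h2 : known Λ.role u ≤ r ^ 2) (hl : count Λ.role .flag true u = 0) :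
    |Λ.signed u| ≤ Λ.potential u := by
  have hr1 : (0 : ℝ) < r := by exact_mod_cast (by omega : 0 < r)
  have hr2 : (2 : ℝ) ≤ r := by exact_mod_cast hr
  have h6 : known Λ.role u ≤ r ^ 6 := h2.trans (Nat.pow_le_pow_right (by omega) (by norm_num))
  rw [Λ.potential_eq h6]
  refine (Λ.abs_signed_le hr).trans ?_
  have hB := Λ.plainMass_nonneg hr u
  have hA := Λ.flaggedMass_nonneg hr u
  have hb := Λ.base_nonneg u
  have hbB := Λ.base_le_plainMass hr h2 hl
  have t0 : (0 : ℝ) ≤ known Λ.role u := by positivity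
  have ht : (known Λ.role u : ℝ) ≤ (r : ℝ) ^ 2 := by exact_mod_cast h2
  have a1 := Λ.abs_voteFactor_sub_le h2 hr (s := 1) (k := 4) (by norm_num) (by norm_num)
  have a2 := Λ.abs_voteFactor_sub_le h2 hr (s := -1) (k := 4) (by norm_num) (by norm_num)
  have a3 := Λ.abs_voteFactor_sub_le h2 hr (s := -1) (k := 3) (by norm_num) (by norm_num)
  have a4 := Λ.abs_voteFactor_sub_le h2 hr (s := - -1) (k := 3) (by norm_num) (by norm_num)
  have hz : (count Λ.role .flag false u : ℝ) ≤ known Λ.role u := by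
    have : count Λ.role .flag false u ≤ known Λ.role u := by unfold known; omega
    exact_mod_cast this
  have hz0 : (0 : ℝ) ≤ count Λ.role .flag false u := by positivity
  have main : |(Λ.plain 1 u - Λ.plain (-1) u) + 1 / r * (Λ.flagged 1 u - Λ.flagged (-1) u)| ≤
      1 / (r : ℝ) ^ 5 * (Λ.base u * (lead Λ.role u ^ 2 + 5 * known Λ.role u)) := by
    unfold plain flagged
    simp only [world_eq, noFlag, oneFlag, hl, if_true, mul_one]
    generalize (1 + 1 / (r : ℝ) ^ 4) ^ count Λ.role .vote true u *
      (1 - 1 / (r : ℝ) ^ 4) ^ count Λ.role .vote false u = g1 at *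
    generalize (1 + -1 / (r : ℝ) ^ 4) ^ count Λ.role .vote true u *
      (1 - -1 / (r : ℝ) ^ 4) ^ count Λ.role .vote false u = g2 at *
    generalize (1 + -1 / (r : ℝ) ^ 3) ^ count Λ.role .vote true u *
      (1 - -1 / (r : ℝ) ^ 3) ^ count Λ.role .vote false u = g3 at *
    generalize (1 + - -1 / (r : ℝ) ^ 3) ^ count Λ.role .vote true u *
      (1 - - -1 / (r : ℝ) ^ 3) ^ count Λ.role .vote false u = g4 at *
    generalize (known Λ.role u : ℝ) = t at *
    generalize (count Λ.role .flag false u : ℝ) = z at *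
    generalize lead Λ.role u = d at *
    have k4 : t * ((r : ℝ) ^ 2 / (r : ℝ) ^ (2 * 4)) ≤ 1 / (r : ℝ) ^ 5 * t := by
      calc _ = 1 / (r : ℝ) ^ 5 * t * (1 / r) := by field_simp
        _ ≤ 1 / (r : ℝ) ^ 5 * t * 1 := by
          refine mul_le_mul_of_nonneg_left ?_ (by positivity)
          rw [div_le_one hr1]; linarith
        _ = _ := mul_one _
    have k3 : 1 / r * (t * ((r : ℝ) ^ 2 / (r : ℝ) ^ (2 * 3))) = 1 / (r : ℝ) ^ 5 * t := by
      field_simp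
      ring
    have h0 : 0 ≤ 1 - z / (r : ℝ) ^ 2 := by
      rw [sub_nonneg, div_le_one (by positivity)]; linarith
    have h1 : 1 - z / (r : ℝ) ^ 2 ≤ 1 := by
      have : 0 ≤ z / (r : ℝ) ^ 2 := by positivity
      linarith
    -- Three remainders: `e12` and `e34` are of second order in the plain and flagged votes; `ez` is
    -- the uncancelled first-order term, handled by AM–GM and (z/r)² ≤ t, from z ≤ t ≤ r².
    have e12 : |g1 - g2 - 2 * d * (1 / (r : ℝ) ^ 4)| ≤ 2 * (1 / (r : ℝ) ^ 5 * t) := by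
      rw [show g1 - g2 - 2 * d * (1 / (r : ℝ) ^ 4) = (g1 - 1 - d * (1 / (r : ℝ) ^ 4)) -
        (g2 - 1 - d * (-1 / (r : ℝ) ^ 4)) by ring]
      refine (abs_sub _ _).trans ?_
      linarith
    have e34 : |(1 - z / (r : ℝ) ^ 2) * (1 / r * (g3 - g4 + 2 * d * (1 / (r : ℝ) ^ 3)))| ≤
        2 * (1 / (r : ℝ) ^ 5 * t) := by
      rw [show g3 - g4 + 2 * d * (1 / (r : ℝ) ^ 3) = (g3 - 1 - d * (-1 / (r : ℝ) ^ 3)) -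
        (g4 - 1 - d * (- -1 / (r : ℝ) ^ 3)) by ring, abs_mul, abs_of_nonneg h0, abs_mul,
        abs_of_nonneg (by positivity : (0 : ℝ) ≤ 1 / r)]
      refine (mul_le_of_le_one_left (by positivity) h1).trans ?_
      rw [← k3]
      have := mul_le_mul_of_nonneg_left ((abs_sub _ _).trans (add_le_add a3 a4))
        (by positivity : (0 : ℝ) ≤ 1 / r)
      linarith
    have ez : |2 * d * (z / (r : ℝ) ^ 6)| ≤ 1 / (r : ℝ) ^ 5 * (d ^ 2 + t) := by
      rw [abs_mul, abs_mul, abs_two, abs_of_nonneg (by positivity : 0 ≤ z / (r : ℝ) ^ 6)]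
      have hs : 2 * |d| * (z / r) ≤ d ^ 2 + t := by
        have hz2 : (z / r) ^ 2 ≤ t := by
          rw [div_pow, div_le_iff₀ (by positivity)]
          nlinarith
        nlinarith [sq_nonneg (|d| - z / r), sq_abs d]
      calc _ = 1 / (r : ℝ) ^ 5 * (2 * |d| * (z / r)) := by field_simp
        _ ≤ _ := by gcongr
    rw [show Λ.base u * g1 - Λ.base u * g2 + 1 / r * (Λ.base u * g3 * (1 - z / (r : ℝ) ^ 2) -
        Λ.base u * g4 * (1 - z / (r : ℝ) ^ 2)) = Λ.base u * ((g1 - g2 - 2 * d * (1 / (r : ℝ) ^ 4)) +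
        (1 - z / (r : ℝ) ^ 2) * (1 / r * (g3 - g4 + 2 * d * (1 / (r : ℝ) ^ 3))) +
        2 * d * (z / (r : ℝ) ^ 6)) by field_simp; ring, abs_mul, abs_of_nonneg hb,
      mul_left_comm (1 / (r : ℝ) ^ 5)]
    refine mul_le_mul_of_nonneg_left ?_ hb
    refine (abs_add_le _ _).trans ((add_le_add (abs_add_le _ _) le_rfl).trans ?_)
    linarith
  have q1 := Λ.plainMass_mul_sq_le hr h6
  have v1 := Λ.plainVar_nonneg hr u
  have v2 := Λ.flaggedVar_nonneg hr u
  have t1 := mul_nonneg t0 hB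
  have t2 := mul_nonneg t0 hA
  have f := Λ.found_nonneg hr u
  refine (add_le_add main le_rfl).trans ?_
  rw [← mul_add]
  refine mul_le_mul_of_nonneg_left ?_ (by positivity)
  have m1 := mul_le_mul_of_nonneg_right hbB
    (by positivity : 0 ≤ lead Λ.role u ^ 2 + 5 * (known Λ.role u : ℝ))
  unfold mass
  rw [mul_add (known Λ.role u : ℝ)]
  linarith

theorem abs_signed_le_potential (hr : 2 ≤ r) (u : Fin n → Option Bool) :
    |Λ.signed u| ≤ Λ.potential u := by
  by_cases h6 : known Λ.role u ≤ r ^ 6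
  · rcases le_total (r ^ 2) (known Λ.role u) with h2 | h2
    · exact Λ.abs_signed_le_of_le_known hr h2 h6
    · rcases Nat.eq_zero_or_pos (count Λ.role .flag true u) with hl | hl
      · exact Λ.abs_signed_le_of_not_found hr h2 hl
      · exact Λ.abs_signed_le_of_found hr h2 hl
  · have hr1 : (1 : ℝ) ≤ r := by exact_mod_cast (by omega : 1 ≤ r)
    unfold potential
    rw [if_neg h6]
    have b1 := Λ.plain_nonneg hr (s := 1) (by norm_num) u
    have b2 := Λ.plain_nonneg hr (s := -1) (by norm_num) u
    have a1 := Λ.flagged_nonneg hr (s := 1) (by norm_num) u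
    have a2 := Λ.flagged_nonneg hr (s := -1) (by norm_num) u
    have hX := abs_le.mp (Λ.abs_parity_le_one u)
    have hinv : 1 / (r : ℝ) ≤ 1 := by rw [div_le_one (by linarith)]; exact hr1
    have hinv0 : 0 ≤ 1 / (r : ℝ) := by positivity
    have i1 : |Λ.flagged 1 u - Λ.flagged (-1) u + (Λ.flagged 1 u + Λ.flagged (-1) u) *
        Λ.parity u| ≤ 2 * (Λ.flagged 1 u + Λ.flagged (-1) u) := by
      rw [abs_le]; constructor <;> nlinarith
    have i2 : |1 / (r : ℝ) * (Λ.flagged 1 u - Λ.flagged (-1) u + (Λ.flagged 1 u +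
        Λ.flagged (-1) u) * Λ.parity u)| ≤ 2 * (Λ.flagged 1 u + Λ.flagged (-1) u) := by
      rw [abs_mul, abs_of_nonneg hinv0]
      exact (mul_le_of_le_one_left (abs_nonneg _) hinv).trans i1
    have i3 : |Λ.plain 1 u - Λ.plain (-1) u| ≤ 2 * (Λ.plain 1 u + Λ.plain (-1) u) := by
      rw [abs_le]; constructor <;> linarith
    unfold signed mass plainMass flaggedMass
    refine (abs_add_le _ _).trans ?_
    linarith

/-! ### Growth of the potential per query. -/

/-- A query hits the set flag with probability 1/r², which the factor r² compensates. For each vote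
sign this adds at most twice the base weight plus a term linear in the lead; the linear terms cancel
between the signs, and the base weight is at most the plain mass. When the penalty expires it only
drops. -/
theorem found_reveal_add_le (hr : 2 ≤ r) {u : Fin n → Option Bool} {i : Fin n}
    (hi : u i = none) :
    Λ.found (reveal u i false) + Λ.found (reveal u i true) ≤ Λ.found u + 4 * Λ.mass u := by
  have hB := Λ.plainMass_nonneg hr u
  have hA := Λ.flaggedMass_nonneg hr u
  have hM := Λ.mass_nonneg hr u
  have hr1 : (0 : ℝ) < r := by exact_mod_cast (by omega : 0 < r)
  have hfound := Λ.found_nonneg hr u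
  unfold found at hfound ⊢
  simp only [known_reveal _ _ _ _ hi]
  by_cases ht : known Λ.role u + 1 ≤ r ^ 2
  swap
  · rw [if_neg (by tauto), if_neg (by tauto)]
    linarith
  rcases Nat.eq_zero_or_pos (count Λ.role .flag true u) with hl | hl
  · have z0 : count Λ.role .flag true (reveal u i false) = 0 := by
      rw [count_reveal _ _ _ _ hi, hl]; simp
    rw [z0, hl]
    by_cases hf : Λ.role i = .flag
    · have hl1 : count Λ.role .flag true (reveal u i true) = 1 := by
        rw [count_reveal _ _ _ _ hi, hl]; simp [hf]
      rw [hl1]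
      simp only [ht, and_true, if_true, Nat.le_refl, Nat.one_ne_zero, Nat.le_zero_eq, if_false,
        zero_add, false_and]
      have h2 : known Λ.role u ≤ r ^ 2 := by omega
      have hbB := Λ.base_le_plainMass hr h2 hl
      have hfl : ∀ s, |s| = 1 → (r : ℝ) ^ 2 * Λ.flagged s (reveal u i true) ≤
          2 * Λ.base u + Λ.base u * (lead Λ.role u * (-s / (r : ℝ) ^ 3)) := by
        intro s hs
        have a := (abs_le.mp (Λ.abs_voteFactor_sub_le h2 hr (s := -s) (k := 3)
          (by rwa [abs_neg]) le_rfl)).2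
        have ht' : (known Λ.role u : ℝ) ≤ (r : ℝ) ^ 2 := by exact_mod_cast h2
        have hs : (known Λ.role u : ℝ) * ((r : ℝ) ^ 2 / (r : ℝ) ^ (2 * 3)) ≤ 1 := by
          have hr2 : (1 : ℝ) ≤ r := by exact_mod_cast (by omega : 1 ≤ r)
          calc _ ≤ (r : ℝ) ^ 2 * ((r : ℝ) ^ 2 / (r : ℝ) ^ (2 * 3)) :=
                mul_le_mul_of_nonneg_right ht' (by positivity)
            _ = 1 / (r : ℝ) ^ 2 := by field_simp
            _ ≤ 1 := by rw [div_le_one (by positivity)]; exact one_le_pow₀ hr2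
        have e : (r : ℝ) ^ 2 * Λ.flagged s (reveal u i true) = Λ.base u *
            ((1 + -s / (r : ℝ) ^ 3) ^ count Λ.role .vote true u *
              (1 - -s / (r : ℝ) ^ 3) ^ count Λ.role .vote false u) := by
          unfold flagged
          rw [world_eq, hl1]
          simp only [base, count_reveal _ _ _ _ hi, hf, oneFlag]
          simp only [reduceCtorEq, false_and, if_false, add_zero, one_ne_zero, if_true]
          field_simp
        rw [e, show 2 * Λ.base u + Λ.base u * (lead Λ.role u * (-s / (r : ℝ) ^ 3)) =
          Λ.base u * (2 + lead Λ.role u * (-s / (r : ℝ) ^ 3)) by ring]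
        exact mul_le_mul_of_nonneg_left (by linarith) (Λ.base_nonneg u)
      have f1 := hfl 1 (by norm_num)
      have f2 := hfl (-1) (by norm_num)
      unfold mass at *
      rw [show - -1 / (r : ℝ) ^ 3 = - (-1 / (r : ℝ) ^ 3) by ring] at f2
      have e : Λ.flaggedMass (reveal u i true) =
        Λ.flagged 1 (reveal u i true) + Λ.flagged (-1) (reveal u i true) := rfl
      rw [e]
      linarith
    · have z1 : count Λ.role .flag true (reveal u i true) = 0 := by
        rw [count_reveal _ _ _ _ hi, hl]; simp [hf]
      rw [z1]
      simp only [Nat.le_zero_eq, Nat.one_ne_zero, false_and, if_false]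
      linarith
  · have h : ∀ b, 1 ≤ count Λ.role .flag true (reveal u i b) := by
      intro b; rw [count_reveal _ _ _ _ hi]; omega
    rw [if_pos ⟨h _, ht⟩, if_pos ⟨h _, ht⟩, if_pos ⟨hl, by omega⟩, ← mul_add]
    have : Λ.flaggedMass (reveal u i false) + Λ.flaggedMass (reveal u i true) =
        Λ.flaggedMass u := by
      unfold flaggedMass
      linear_combination Λ.flagged_reveal_add 1 hi + Λ.flagged_reveal_add (-1) hi
    rw [this]
    linarith

/-- The constant is 14 = 8 + 2 + 4, from the query count, the variances and `found`. -/
theorem potential_reveal_add_le (hr : 2 ≤ r) (u : Fin n → Option Bool) (i : Fin n)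
    (hi : u i = none) :
    Λ.potential (reveal u i false) + Λ.potential (reveal u i true) ≤
      Λ.potential u + if known Λ.role u < r ^ 6 then 14 / (r : ℝ) ^ 5 * Λ.mass u else 0 := by
  have hr1 : (0 : ℝ) < r := by exact_mod_cast (by omega : 0 < r)
  have hadd := Λ.mass_reveal_add hi
  have hM := Λ.mass_nonneg hr u
  by_cases ht : known Λ.role u < r ^ 6
  · rw [if_pos ht, Λ.potential_eq ht.le, Λ.potential_eq (by rw [known_reveal _ _ _ _ hi]; omega),
      Λ.potential_eq (by rw [known_reveal _ _ _ _ hi]; omega)]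
    rw [known_reveal _ _ _ _ hi, known_reveal _ _ _ _ hi, ← mul_add]
    have h1 := Λ.found_reveal_add_le hr hi
    have h2 := Λ.plainVar_add_flaggedVar_reveal_le hr hi
    rw [show 14 / (r : ℝ) ^ 5 * Λ.mass u = 1 / (r : ℝ) ^ 5 * (14 * Λ.mass u) by ring, ← mul_add]
    refine mul_le_mul_of_nonneg_left ?_ (by positivity)
    push_cast
    rw [← hadd] at h1 h2 ⊢
    linarith
  · have hk : ∀ b, ¬ known Λ.role (reveal u i b) ≤ r ^ 6 := by
      intro b; rw [known_reveal _ _ _ _ hi]; omega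
    rw [if_neg ht, add_zero]
    unfold potential
    rw [if_neg (hk _), if_neg (hk _), ← mul_add, hadd]
    split
    -- On crossing the threshold the potential falls from at least 8r times the mass to twice the
    -- mass.
    · have h6 : known Λ.role u = r ^ 6 := by omega
      have v1 := Λ.plainVar_nonneg hr u
      have v2 := Λ.flaggedVar_nonneg hr u
      have f := Λ.found_nonneg hr u
      have hr2 : (2 : ℝ) ≤ r := by exact_mod_cast hr
      rw [h6]
      push_cast
      calc 2 * Λ.mass u ≤ 8 * r * Λ.mass u := by gcongr; linarith
        _ = 1 / (r : ℝ) ^ 5 * (8 * ((r : ℝ) ^ 6 * Λ.mass u)) := by field_simp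
        _ ≤ _ := by gcongr; linarith
    · exact le_rfl

theorem potential_none : Λ.potential (fun _ => none) = 0 := by
  have h : ∀ k b, count Λ.role k b (fun _ => none) = 0 := by intro k b; simp [count]
  simp [potential, known, plainVar, flaggedVar, found, lead, votes, h]

/-- A decision tree of small truncated cost is hardly correlated with the hard measure. -/
theorem abs_sum_signed_mul_le (hr : 2 ≤ r) (T : DecisionTree n) :
    |∑ x : Fin n → Bool, Λ.signed (full x) * sgn (T.1.eval x)| ≤
      14 / (r : ℝ) ^ 5 *
        ∑ x : Fin n → Bool, Λ.mass (full x) * ((min (T.1.cost x) (r ^ 6) : ℕ) : ℝ) := by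
  have := T.1.abs_sum_sgn_le Λ.signed Λ.mass Λ.potential (14 / (r : ℝ) ^ 5) (known Λ.role) (r ^ 6)
    (fun u i => Λ.signed_reveal_add) (fun u i => Λ.mass_reveal_add)
    (fun u i b hi => known_reveal _ u i b hi) (Λ.abs_signed_le_potential hr)
    (Λ.potential_reveal_add_le hr) ∅ T.2 (fun _ => none) (fun _ _ => rfl)
  have h : known Λ.role (fun _ => none) = 0 := by simp [known, count]
  rw [cylinder_none, Λ.potential_none, h, zero_add, Nat.sub_zero] at this
  exact this

end bounds

end Layout

/-! ### Averaging pointwise inequalities over a random tree. -/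

theorem expect_mono {α : Type*} (p : PMF α) {g h : α → ℝ≥0∞} (hgh : ∀ a, g a ≤ h a) :
    expect p g ≤ expect p h :=
  ENNReal.tsum_le_tsum fun a => mul_le_mul_right (hgh a) _

theorem expect_const {α : Type*} (p : PMF α) (c : ℝ≥0∞) : expect p (fun _ => c) = c := by
  rw [expect, ENNReal.tsum_mul_right, p.tsum_coe, one_mul]

theorem expect_sum {α ι : Type*} [Fintype ι] (p : PMF α) (c : ι → ℝ≥0∞) (g : ι → α → ℝ≥0∞) :
    expect p (fun a => ∑ i, c i * g i a) = ∑ i, c i * expect p (g i) := by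
  unfold expect
  simp_rw [Finset.mul_sum]
  rw [Summable.tsum_finsetSum fun _ _ => ENNReal.summable]
  refine Finset.sum_congr rfl fun i _ => ?_
  rw [← ENNReal.tsum_mul_left]
  exact tsum_congr fun a => by ring

/-- An inequality with nonnegative coefficients that holds pointwise holds for upper bounds of the
expectations. -/
theorem le_sum_of_expect_le {α ι : Type*} [Fintype ι] (p : PMF α) {W : ℝ} {c b : ι → ℝ}
    {g : ι → α → ℝ} (hc : ∀ i, 0 ≤ c i) (hb : ∀ i, 0 ≤ b i) (hg : ∀ i a, 0 ≤ g i a)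
    (hW : ∀ a, W ≤ ∑ i, c i * g i a)
    (hgb : ∀ i, expect p (fun a => ENNReal.ofReal (g i a)) ≤ ENNReal.ofReal (b i)) :
    W ≤ ∑ i, c i * b i := by
  have h0 : 0 ≤ ∑ i, c i * b i := Finset.sum_nonneg fun i _ => mul_nonneg (hc i) (hb i)
  rw [← ENNReal.ofReal_le_ofReal_iff h0, ← expect_const p (ENNReal.ofReal W)]
  calc expect p (fun _ => ENNReal.ofReal W)
      ≤ expect p (fun a => ∑ i, ENNReal.ofReal (c i) * ENNReal.ofReal (g i a)) := by
        refine expect_mono p fun a => (ENNReal.ofReal_le_ofReal (hW a)).trans_eq ?_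
        rw [ENNReal.ofReal_sum_of_nonneg fun i _ => mul_nonneg (hc i) (hg i a)]
        exact Finset.sum_congr rfl fun i _ => ENNReal.ofReal_mul (hc i)
    _ = ∑ i, ENNReal.ofReal (c i) * expect p (fun a => ENNReal.ofReal (g i a)) :=
        expect_sum p _ _
    _ ≤ ∑ i, ENNReal.ofReal (c i) * ENNReal.ofReal (b i) :=
        Finset.sum_le_sum fun i _ => mul_le_mul_right (hgb i) _
    _ = _ := by
        rw [ENNReal.ofReal_sum_of_nonneg fun i _ => mul_nonneg (hc i) (hb i)]
        exact Finset.sum_congr rfl fun i _ => (ENNReal.ofReal_mul (hc i)).symm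

theorem sgn_true : sgn true = 1 := rfl

theorem sgn_false : sgn false = -1 := rfl

namespace Layout

variable {n r : ℕ} (Λ : Layout n r)

/-! ### The separating function and the worst-case lower bound. -/

/-- The separating function. If no flag is set, it is the majority of the votes, provided that
the margin is at least a fraction `1 / (2 r⁴)`. If exactly one flag is set, it is the parity of the
payload, provided that the margin of the votes is at most a fraction `2 / r³`. -/
noncomputable def fn : PartialFn n := fun x =>
  if count Λ.role .flag true (full x) = 0 then
    if (size Λ.role .vote : ℝ) / (2 * (r : ℝ) ^ 4) ≤ lead Λ.role (full x) then some true
    else if lead Λ.role (full x) ≤ -((size Λ.role .vote : ℝ) / (2 * (r : ℝ) ^ 4)) then some false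
    else none
  else if count Λ.role .flag true (full x) = 1 ∧
      |lead Λ.role (full x)| ≤ 2 * size Λ.role .vote / (r : ℝ) ^ 3 then
    some (decide (Even (count Λ.role .payload true (full x))))
  else none

/-- The squared deviation of the lead from `y` times the number of votes, normalised. -/
noncomputable def dev (y : ℝ) (x : Fin n → Bool) : ℝ :=
  (lead Λ.role (full x) - y * size Λ.role .vote) ^ 2 /
    ((size Λ.role .vote : ℝ) / (2 * (r : ℝ) ^ 4)) ^ 2

theorem dev_nonneg (y : ℝ) (x : Fin n → Bool) : 0 ≤ Λ.dev y x := by unfold dev; positivity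

theorem one_le_dev (hr : 2 ≤ r) (hN : 0 < size Λ.role .vote) {y : ℝ} {x : Fin n → Bool}
    (h : (size Λ.role .vote : ℝ) / (2 * (r : ℝ) ^ 4) ≤
      |lead Λ.role (full x) - y * size Λ.role .vote|) : 1 ≤ Λ.dev y x := by
  have hN' : (0 : ℝ) < size Λ.role .vote := by exact_mod_cast hN
  have hr1 : (0 : ℝ) < r := by exact_mod_cast (by omega : 0 < r)
  unfold dev
  rw [one_le_div (by positivity), ← sq_abs (lead Λ.role (full x) - _)]
  exact pow_le_pow_left₀ (by positivity) h 2

theorem sum_world_mul_dev_le (hr : 2 ≤ r) (hN : 0 < size Λ.role .vote) {y : ℝ} (hy : |y| ≤ 1)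
    {F : ℕ → ℕ → ℝ} (hF : FlagAdditive F)
    (h0 : ∀ u : Fin n → Option Bool,
      0 ≤ F (count Λ.role .flag false u) (count Λ.role .flag true u)) (hF1 : F 0 0 = 1) :
    ∑ x : Fin n → Bool, world Λ.role y F (full x) * Λ.dev y x ≤
      4 * (r : ℝ) ^ 8 / size Λ.role .vote := by
  have hN' : (0 : ℝ) < size Λ.role .vote := by exact_mod_cast hN
  have hr1 : (0 : ℝ) < r := by exact_mod_cast (by omega : 0 < r)
  have := sum_world_mul_sq_le Λ.role hy hF h0 hF1
  unfold dev
  simp only [← mul_div_assoc, ← Finset.sum_div]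
  rw [div_le_iff₀ (by positivity)]
  refine this.trans_eq ?_
  field_simp
  norm_num

theorem sum_plain_mul_dev_le (hr : 2 ≤ r) (hN : 0 < size Λ.role .vote) (b : Bool) :
    ∑ x : Fin n → Bool, Λ.plain (sgn b) (full x) * Λ.dev (sgn b / (r : ℝ) ^ 4) x ≤
      4 * (r : ℝ) ^ 8 / size Λ.role .vote :=
  Λ.sum_world_mul_dev_le hr hN (abs_div_pow_le (abs_sgn b).le hr) flagAdditive_noFlag
    (fun _ => noFlag_nonneg _ _) (by simp [noFlag])

theorem sum_flagged_mul_dev_le (hr : 2 ≤ r) (hN : 0 < size Λ.role .vote) (b : Bool) :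
    ∑ x : Fin n → Bool, Λ.flagged (sgn b) (full x) * Λ.dev (-sgn b / (r : ℝ) ^ 3) x ≤
      4 * (r : ℝ) ^ 8 / size Λ.role .vote :=
  Λ.sum_world_mul_dev_le hr hN (abs_div_pow_le (by rw [abs_neg, abs_sgn]) hr)
    (flagAdditive_oneFlag r) (Λ.oneFlag_count_nonneg hr) (by simp [oneFlag])

theorem sum_world_full (y : ℝ) {F : ℕ → ℕ → ℝ} (hF : FlagAdditive F) (hF1 : F 0 0 = 1) :
    ∑ x : Fin n → Bool, world Λ.role y F (full x) = 1 := by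
  have := sum_full_eq _ (world_reveal_add Λ.role y hF) (fun _ : Fin n => none)
  rw [cylinder_none] at this
  rw [this]
  simp [world, count, hF1]

theorem sum_plain (s : ℝ) : ∑ x : Fin n → Bool, Λ.plain s (full x) = 1 :=
  Λ.sum_world_full _ flagAdditive_noFlag (by simp [noFlag])

theorem sum_flagged (s : ℝ) : ∑ x : Fin n → Bool, Λ.flagged s (full x) = 1 :=
  Λ.sum_world_full _ (flagAdditive_oneFlag r) (by simp [oneFlag])

theorem sum_flagged_mul_parity (hr : 2 ≤ r) (s : ℝ) :
    ∑ x : Fin n → Bool, Λ.flagged s (full x) * Λ.parity (full x) = 0 := by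
  have := sum_full_eq (fun u => Λ.flagged s u * Λ.parity u)
    (fun u i => Λ.flagged_mul_parity_reveal_add s) (fun _ : Fin n => none)
  rw [cylinder_none] at this
  rw [this]
  have h : (0 : ℕ) ≠ r ^ 4 := (pow_pos (by omega) 4).ne
  simp [parity, count, h]

theorem plain_full_eq_zero {x : Fin n → Bool} (s : ℝ)
    (h : count Λ.role .flag true (full x) ≠ 0) : Λ.plain s (full x) = 0 := by
  simp [plain, world, noFlag, h]

theorem flagged_full_eq_zero (hr : 2 ≤ r) {x : Fin n → Bool} (s : ℝ)
    (h : count Λ.role .flag true (full x) ≠ 1) : Λ.flagged s (full x) = 0 := by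
  have hc := count_full_add Λ.role .flag x
  rw [Λ.size_flag] at hc
  have hr1 : (0 : ℝ) < r := by exact_mod_cast (by omega : 0 < r)
  unfold flagged world oneFlag
  by_cases h0 : count Λ.role .flag true (full x) = 0
  · rw [h0, zero_add] at hc
    rw [if_pos h0, hc]
    push_cast
    rw [div_self (by positivity), sub_self, mul_zero]
  · rw [if_neg h0, if_neg h, mul_zero]

theorem parity_full (x : Fin n → Bool) :
    Λ.parity (full x) = sgn (decide (Even (count Λ.role .payload true (full x)))) := by
  have hc := count_full_add Λ.role .payload x
  rw [Λ.size_payload] at hc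
  unfold parity
  rw [if_pos hc]
  by_cases h : Even (count Λ.role .payload true (full x))
  · simp [h, sgn]
  · simp [h, sgn, Nat.not_even_iff_odd.mp h]

/-- Pointwise Markov inequality: the expected lead has size N/r⁴, twice the threshold of `fn`, so
missing the value b means deviating by at least N/(2r⁴). -/
theorem plain_mul_le (hr : 2 ≤ r) (hN : 0 < size Λ.role .vote) (b : Bool) (x : Fin n → Bool)
    (hf : Λ.fn x ≠ some b) : Λ.plain (sgn b) (full x) ≤
      Λ.plain (sgn b) (full x) * Λ.dev (sgn b / (r : ℝ) ^ 4) x := by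
  have hp := Λ.plain_nonneg hr (abs_sgn b).le (full x)
  by_cases h0 : count Λ.role .flag true (full x) = 0
  · refine le_mul_of_one_le_right hp (Λ.one_le_dev hr hN ?_)
    have hr1 : (0 : ℝ) < r := by exact_mod_cast (by omega : 0 < r)
    have hN' : (0 : ℝ) < size Λ.role .vote := by exact_mod_cast hN
    have e : 1 / (r : ℝ) ^ 4 * size Λ.role .vote =
        2 * ((size Λ.role .vote : ℝ) / (2 * (r : ℝ) ^ 4)) := by field_simp
    have hpos : 0 < (size Λ.role .vote : ℝ) / (2 * (r : ℝ) ^ 4) := by positivity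
    unfold fn at hf
    rw [if_pos h0] at hf
    rw [le_abs]
    cases b
    · left
      rw [sgn_false, neg_div, neg_mul, e]
      split_ifs at hf
      · linarith
      · exact absurd rfl hf
      · linarith
    · right
      rw [sgn_true, e]
      split_ifs at hf
      · exact absurd rfl hf
      · linarith
      · linarith
  · rw [Λ.plain_full_eq_zero _ h0, zero_mul]

/-- The expected lead has size N/r³, so a lead beyond 2N/r³ deviates by more than N/r³ ≥ N/(2r⁴). -/
theorem flagged_mul_le (hr : 2 ≤ r) (hN : 0 < size Λ.role .vote) (b : Bool) (x : Fin n → Bool)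
    (hf : Λ.fn x = none) : Λ.flagged (sgn b) (full x) ≤
      Λ.flagged (sgn b) (full x) * Λ.dev (-sgn b / (r : ℝ) ^ 3) x := by
  have hp := Λ.flagged_nonneg hr (abs_sgn b).le (full x)
  by_cases h1 : count Λ.role .flag true (full x) = 1
  · refine le_mul_of_one_le_right hp (Λ.one_le_dev hr hN ?_)
    have hr1 : (1 : ℝ) ≤ r := by exact_mod_cast (by omega : 1 ≤ r)
    have hN' : (0 : ℝ) < size Λ.role .vote := by exact_mod_cast hN
    unfold fn at hf
    rw [if_neg (by omega)] at hf
    have hlt : 2 * size Λ.role .vote / (r : ℝ) ^ 3 < |lead Λ.role (full x)| := by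
      by_contra hle
      rw [if_pos ⟨h1, not_lt.mp hle⟩] at hf
      cases hf
    have e1 : |(-sgn b / (r : ℝ) ^ 3) * size Λ.role .vote| = size Λ.role .vote / (r : ℝ) ^ 3 := by
      rw [abs_mul, abs_div, abs_neg, abs_sgn, abs_of_nonneg (by positivity : (0 : ℝ) ≤ (r : ℝ) ^ 3),
        abs_of_nonneg hN'.le]
      ring
    have e2 : (size Λ.role .vote : ℝ) / (2 * (r : ℝ) ^ 4) ≤ size Λ.role .vote / (r : ℝ) ^ 3 := by
      refine div_le_div_of_nonneg_left hN'.le (by positivity) ?_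
      nlinarith [pow_pos (lt_of_lt_of_le one_pos hr1) 3]
    have := abs_sub_abs_le_abs_sub (lead Λ.role (full x))
      ((-sgn b / (r : ℝ) ^ 3) * size Λ.role .vote)
    rw [e1] at this
    have e3 : 2 * size Λ.role .vote / (r : ℝ) ^ 3 = 2 * (size Λ.role .vote / (r : ℝ) ^ 3) := by ring
    linarith
  · rw [Λ.flagged_full_eq_zero hr _ h1, zero_mul]

/-- The part of the hard measure that is supported on inputs with value `b`, up to atypical
inputs. -/
noncomputable def hard (b : Bool) (x : Fin n → Bool) : ℝ :=
  Λ.plain (sgn b) (full x) +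
    1 / r * (Λ.flagged (sgn b) (full x) * (1 + sgn b * Λ.parity (full x)))

theorem hard_nonneg (hr : 2 ≤ r) (b : Bool) (x : Fin n → Bool) : 0 ≤ Λ.hard b x := by
  have h1 := Λ.plain_nonneg hr (abs_sgn b).le (full x)
  have h2 := Λ.flagged_nonneg hr (abs_sgn b).le (full x)
  have h3 : |sgn b * Λ.parity (full x)| ≤ 1 := by
    rw [abs_mul, abs_sgn, one_mul]; exact Λ.abs_parity_le_one _
  have h4 : 0 ≤ 1 + sgn b * Λ.parity (full x) := by linarith [(abs_le.mp h3).1]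
  unfold hard
  positivity

theorem signed_full (x : Fin n → Bool) :
    Λ.signed (full x) = Λ.hard true x - Λ.hard false x := by
  unfold signed hard
  rw [sgn_true, sgn_false]
  ring

theorem sum_hard (hr : 2 ≤ r) (b : Bool) : ∑ x : Fin n → Bool, Λ.hard b x = 1 + 1 / r := by
  have e : ∀ x, Λ.hard b x = Λ.plain (sgn b) (full x) + 1 / r * (Λ.flagged (sgn b) (full x)) +
      1 / r * sgn b * (Λ.flagged (sgn b) (full x) * Λ.parity (full x)) := by
    intro x; unfold hard; ring
  simp only [e, Finset.sum_add_distrib, ← Finset.mul_sum, Λ.sum_plain, Λ.sum_flagged,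
    Λ.sum_flagged_mul_parity hr]
  ring

/-- The error that a tree with error at most `ε` on the domain makes under the hard measure. -/
theorem sum_hard_mul_le (hr : 2 ≤ r) (hN : 0 < size Λ.role .vote) (b : Bool) {ε : ℝ}
    (hε : 0 ≤ ε) :
    ∑ x : Fin n → Bool, Λ.hard b x * (if Λ.fn x = some b then ε else 1) ≤
      (1 + 1 / r) * ε + 8 * (r : ℝ) ^ 8 / size Λ.role .vote := by
  have hr2 : (2 : ℝ) ≤ r := by exact_mod_cast hr
  have hpt : ∀ x, Λ.hard b x * (if Λ.fn x = some b then ε else 1) ≤ Λ.hard b x * ε +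
      (Λ.plain (sgn b) (full x) * Λ.dev (sgn b / (r : ℝ) ^ 4) x +
        Λ.flagged (sgn b) (full x) * Λ.dev (-sgn b / (r : ℝ) ^ 3) x) := by
    intro x
    have h1 := Λ.plain_nonneg hr (abs_sgn b).le (full x)
    have h2 := Λ.flagged_nonneg hr (abs_sgn b).le (full x)
    have d1 := mul_nonneg h1 (Λ.dev_nonneg (sgn b / (r : ℝ) ^ 4) x)
    have d2 := mul_nonneg h2 (Λ.dev_nonneg (-sgn b / (r : ℝ) ^ 3) x)
    have hh := Λ.hard_nonneg hr b x
    split_ifs with hf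
    · linarith
    · rw [mul_one]
      have p1 := Λ.plain_mul_le hr hN b x hf
      -- With exactly one flag set, the input is either off the domain, where `dev` pays, or has the
      -- opposite value, where the weight 1 + sgn b · parity vanishes.
      have p2 : 1 / r * (Λ.flagged (sgn b) (full x) * (1 + sgn b * Λ.parity (full x))) ≤
          Λ.flagged (sgn b) (full x) * Λ.dev (-sgn b / (r : ℝ) ^ 3) x := by
        by_cases hnone : Λ.fn x = none
        · have p3 := Λ.flagged_mul_le hr hN b x hnone
          have h3 : |sgn b * Λ.parity (full x)| ≤ 1 := by
            rw [abs_mul, abs_sgn, one_mul]; exact Λ.abs_parity_le_one _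
          have h4 : 1 + sgn b * Λ.parity (full x) ≤ 2 := by linarith [(abs_le.mp h3).2]
          calc _ ≤ 1 / (r : ℝ) * (Λ.flagged (sgn b) (full x) * 2) := by gcongr
            _ = Λ.flagged (sgn b) (full x) * (2 / r) := by ring
            _ ≤ Λ.flagged (sgn b) (full x) * 1 := by
              refine mul_le_mul_of_nonneg_left ?_ h2
              rw [div_le_one (by linarith)]; exact hr2
            _ ≤ _ := by rw [mul_one]; exact p3
        · by_cases hc : count Λ.role .flag true (full x) = 1
          · have : 1 + sgn b * Λ.parity (full x) = 0 := by
              rw [Λ.parity_full]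
              unfold fn at hf hnone
              rw [if_neg (by omega)] at hf hnone
              split_ifs at hf hnone
              · revert hf
                generalize decide (Even (count Λ.role .payload true (full x))) = c
                cases b <;> cases c <;> simp [sgn]
              · exact absurd rfl hnone
            rw [this, mul_zero, mul_zero]
            exact d2
          · rw [Λ.flagged_full_eq_zero hr _ hc]
            simp
      have : Λ.hard b x = Λ.plain (sgn b) (full x) +
        1 / r * (Λ.flagged (sgn b) (full x) * (1 + sgn b * Λ.parity (full x))) := rfl
      have := mul_nonneg hh hε
      linarith
  refine (Finset.sum_le_sum fun x _ => hpt x).trans ?_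
  simp only [Finset.sum_add_distrib, ← Finset.sum_mul, Λ.sum_hard hr]
  have s1 := Λ.sum_plain_mul_dev_le hr hN b
  have s2 := Λ.sum_flagged_mul_dev_le hr hN b
  have : 8 * (r : ℝ) ^ 8 / size Λ.role .vote = 2 * (4 * (r : ℝ) ^ 8 / size Λ.role .vote) := by ring
  linarith

/-- The truncated cost under the total mass. -/
theorem sum_mass_mul_le (hr : 2 ≤ r) (hN : 0 < size Λ.role .vote) {C K : ℝ} (hC : 0 ≤ C)
    (hK : 0 ≤ K) :
    ∑ x : Fin n → Bool, Λ.mass (full x) * (if Λ.fn x ≠ none then C else K) ≤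
      4 * C + K * (16 * (r : ℝ) ^ 8 / size Λ.role .vote) := by
  have hpt : ∀ x, Λ.mass (full x) * (if Λ.fn x ≠ none then C else K) ≤ Λ.mass (full x) * C +
      K * ((Λ.plain (sgn true) (full x) * Λ.dev (sgn true / (r : ℝ) ^ 4) x +
        Λ.flagged (sgn true) (full x) * Λ.dev (-sgn true / (r : ℝ) ^ 3) x) +
        (Λ.plain (sgn false) (full x) * Λ.dev (sgn false / (r : ℝ) ^ 4) x +
        Λ.flagged (sgn false) (full x) * Λ.dev (-sgn false / (r : ℝ) ^ 3) x)) := by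
    intro x
    have hm := Λ.mass_nonneg hr (full x)
    have d1 := fun b => mul_nonneg (Λ.plain_nonneg hr (abs_sgn b).le (full x))
      (Λ.dev_nonneg (sgn b / (r : ℝ) ^ 4) x)
    have d2 := fun b => mul_nonneg (Λ.flagged_nonneg hr (abs_sgn b).le (full x))
      (Λ.dev_nonneg (-sgn b / (r : ℝ) ^ 3) x)
    split_ifs with hf
    · have := mul_nonneg hK (add_nonneg (add_nonneg (d1 true) (d2 true))
        (add_nonneg (d1 false) (d2 false)))
      linarith
    · rw [not_not] at hf
      have p1 := fun b => Λ.plain_mul_le hr hN b x (by simp [hf])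
      have p2 := fun b => Λ.flagged_mul_le hr hN b x hf
      have hs : Λ.mass (full x) = (Λ.plain (sgn true) (full x) + Λ.flagged (sgn true) (full x)) +
          (Λ.plain (sgn false) (full x) + Λ.flagged (sgn false) (full x)) := by
        unfold mass plainMass flaggedMass; rw [sgn_true, sgn_false]; ring
      have := mul_nonneg hm hC
      have h := mul_le_mul_of_nonneg_left (add_le_add (add_le_add (p1 true) (p2 true))
        (add_le_add (p1 false) (p2 false))) hK
      rw [← hs] at h
      linarith
  refine (Finset.sum_le_sum fun x _ => hpt x).trans ?_
  have hmass : ∑ x : Fin n → Bool, Λ.mass (full x) = 4 := by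
    unfold mass plainMass flaggedMass
    simp only [Finset.sum_add_distrib, Λ.sum_plain, Λ.sum_flagged]
    norm_num
  simp only [Finset.sum_add_distrib, ← Finset.sum_mul, ← Finset.mul_sum, hmass]
  have s1 := fun b => Λ.sum_plain_mul_dev_le hr hN b
  have s2 := fun b => Λ.sum_flagged_mul_dev_le hr hN b
  have := mul_le_mul_of_nonneg_left (add_le_add (add_le_add (s1 true) (s2 true))
        (add_le_add (s1 false) (s2 false))) hK
  have e : 16 * (r : ℝ) ^ 8 / size Λ.role .vote = 4 * (4 * (r : ℝ) ^ 8 / size Λ.role .vote) := by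
    ring
  rw [e]
  linarith

/-- The lower bound, for an arbitrary error `(1 - δ) / 2`. -/
theorem two_mul_bias_le (hr : 2 ≤ r) (hN : 0 < size Λ.role .vote) (R : RandTree n) {δ C : ℝ}
    (hδ : 0 ≤ δ) (hδ1 : δ ≤ 1) (hC : 0 ≤ C)
    (herr : ∀ x ∈ Λ.fn.Dom, err Λ.fn R x ≤ ENNReal.ofReal ((1 - δ) / 2))
    (hcost : ∀ x ∈ Λ.fn.Dom, cost R x ≤ ENNReal.ofReal C) :
    2 * δ ≤ 32 * (r : ℝ) ^ 8 / size Λ.role .vote +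
      14 / (r : ℝ) ^ 5 * (4 * C + (r : ℝ) ^ 6 * (16 * (r : ℝ) ^ 8 / size Λ.role .vote)) := by
  have hr1 : (0 : ℝ) < r := by exact_mod_cast (by omega : 0 < r)
  -- Index `(x, some b)` carries the event that the output is not b, and `(x, none)` the truncated
  -- cost. The trivial bounds 1 and r⁶ serve where `fn` does not take the value b, respectively is
  -- undefined. `W` is the total hard mass 2(1 + 1/r).
  have key := le_sum_of_expect_le (ι := (Fin n → Bool) × Option Bool) R
    (W := 2 * (1 + 1 / r + (1 + 1 / (r : ℝ))) / 2)
    (c := fun i => match i with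
      | (x, some b) => 2 * Λ.hard b x
      | (x, none) => 14 / (r : ℝ) ^ 5 * Λ.mass (full x))
    (b := fun i => match i with
      | (x, some b) => if Λ.fn x = some b then (1 - δ) / 2 else 1
      | (x, none) => if Λ.fn x ≠ none then C else (r : ℝ) ^ 6)
    (g := fun i T => match i with
      | (x, some b) => if T.1.eval x = b then 0 else 1
      | (x, none) => ((min (T.1.cost x) (r ^ 6) : ℕ) : ℝ)) ?_ ?_ ?_ ?_ ?_
  · rw [Fintype.sum_prod_type] at key
    simp only [Fintype.sum_option, Fintype.sum_bool, Finset.sum_add_distrib, mul_assoc,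
      ← Finset.mul_sum] at key
    have h1 := Λ.sum_hard_mul_le hr hN true (ε := (1 - δ) / 2) (by linarith)
    have h2 := Λ.sum_hard_mul_le hr hN false (ε := (1 - δ) / 2) (by linarith)
    have h3 := Λ.sum_mass_mul_le hr hN hC (K := (r : ℝ) ^ 6) (by positivity)
    have h4 := mul_le_mul_of_nonneg_left h3 (by positivity : 0 ≤ 14 / (r : ℝ) ^ 5)
    have e : 32 * (r : ℝ) ^ 8 / size Λ.role .vote = 4 * (8 * (r : ℝ) ^ 8 / size Λ.role .vote) := by
      ring
    have : 0 ≤ 1 / (r : ℝ) * δ := by positivity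
    rw [e]
    linarith
  · rintro ⟨x, _ | b⟩
    · have := Λ.mass_nonneg hr (full x); positivity
    · have := Λ.hard_nonneg hr b x; positivity
  · rintro ⟨x, _ | b⟩
    · dsimp only; split <;> positivity
    · dsimp only; split <;> linarith
  · rintro ⟨x, _ | b⟩ T
    · positivity
    · dsimp only; split <;> norm_num
  · intro T
    have h := (abs_le.mp (Λ.abs_sum_signed_mul_le hr T)).2
    rw [Fintype.sum_prod_type]
    simp only [Fintype.sum_option, Fintype.sum_bool, Finset.sum_add_distrib, mul_assoc,
      ← Finset.mul_sum]
    -- Correlation is total hard mass minus twice the mass of errors.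
    have e : ∀ x, Λ.signed (full x) * sgn (T.1.eval x) = Λ.hard true x + Λ.hard false x -
        2 * (Λ.hard true x * (if T.1.eval x = true then 0 else 1)) -
        2 * (Λ.hard false x * (if T.1.eval x = false then 0 else 1)) := by
      intro x
      rw [signed_full]
      cases T.1.eval x <;> simp [sgn] <;> ring
    simp only [e, Finset.sum_sub_distrib, Finset.sum_add_distrib, Λ.sum_hard hr,
      ← Finset.mul_sum] at h
    linarith
  · rintro ⟨x, _ | b⟩
    · dsimp only
      simp only [ENNReal.ofReal_natCast]
      split_ifs with hf
      · exact (expect_mono R fun T => by exact_mod_cast min_le_left _ _).trans (hcost x hf)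
      · refine (expect_mono R (h := fun _ => ENNReal.ofReal ((r : ℝ) ^ 6)) fun T => ?_).trans_eq
          (expect_const R _)
        rw [← Nat.cast_pow, ENNReal.ofReal_natCast]
        exact_mod_cast min_le_right _ _
    · dsimp only
      split_ifs with hf
      · refine le_trans (expect_mono R fun T => ?_) (herr x (by simp [PartialFn.Dom, hf]))
        rw [hf]
        simp only [Option.some.injEq]
        split <;> simp
      · refine (expect_mono R (h := fun _ => ENNReal.ofReal 1) fun T => ?_).trans_eq
          (expect_const R _)
        split <;> simp

end Layout

/-! ### Randomised trees and the distributional upper bound. -/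

theorem expect_bind {α β : Type*} (p : PMF α) (q : α → PMF β) (g : β → ℝ≥0∞) :
    expect (p.bind q) g = expect p fun a => expect (q a) g := by
  unfold expect
  simp only [PMF.bind_apply, ← ENNReal.tsum_mul_right, ← ENNReal.tsum_mul_left]
  rw [ENNReal.tsum_comm]
  simp only [mul_assoc]

theorem expect_pure {α : Type*} (a : α) (g : α → ℝ≥0∞) : expect (PMF.pure a) g = g a := by
  classical
  unfold expect
  rw [tsum_eq_single a]
  · simp
  · intro b hb; simp [PMF.pure_apply, hb]

theorem expect_map {α β : Type*} (p : PMF α) (F : α → β) (g : β → ℝ≥0∞) :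
    expect (p.map F) g = expect p fun a => g (F a) := by
  rw [PMF.map, expect_bind]
  simp only [Function.comp_apply, expect_pure]

theorem expect_uniform {α : Type*} [Fintype α] [Nonempty α] (g : α → ℝ) (hg : ∀ a, 0 ≤ g a) :
    expect (PMF.uniformOfFintype α) (fun a => ENNReal.ofReal (g a)) =
      ENNReal.ofReal ((∑ a, g a) / Fintype.card α) := by
  unfold expect
  rw [tsum_fintype]
  simp only [PMF.uniformOfFintype_apply]
  rw [← Finset.mul_sum, ← ENNReal.ofReal_sum_of_nonneg fun a _ => hg a, mul_comm,
    ← div_eq_mul_inv, ENNReal.ofReal_div_of_pos (by exact_mod_cast Fintype.card_pos),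
    ENNReal.ofReal_natCast]

theorem expect_add {α : Type*} (p : PMF α) (g h : α → ℝ≥0∞) :
    expect p (fun a => g a + h a) = expect p g + expect p h := by
  unfold expect
  simp only [mul_add]
  exact ENNReal.tsum_add

theorem expect_const_mul {α : Type*} (p : PMF α) (c : ℝ≥0∞) (g : α → ℝ≥0∞) :
    expect p (fun a => c * g a) = c * expect p g := by
  unfold expect
  rw [← ENNReal.tsum_mul_left]
  exact tsum_congr fun a => by ring

/-- The mixture of `p` with weight `t` and `q` with weight `1 - t`. -/
noncomputable def mix {α : Type*} (t : ℝ) (ht : 0 ≤ t ∧ t ≤ 1) (p q : PMF α) : PMF α :=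
  (PMF.ofFintype (fun b : Bool => ENNReal.ofReal (if b then t else 1 - t)) (by
    rw [Fintype.sum_bool]
    simp only [if_true, Bool.false_eq_true, if_false]
    rw [← ENNReal.ofReal_add ht.1 (by linarith [ht.2])]
    simp)).bind fun b => if b then p else q

theorem expect_mix {α : Type*} {t : ℝ} (ht : 0 ≤ t ∧ t ≤ 1) (p q : PMF α) (g : α → ℝ≥0∞) :
    expect (mix t ht p q) g =
      ENNReal.ofReal t * expect p g + ENNReal.ofReal (1 - t) * expect q g := by
  rw [mix, expect_bind, expect, tsum_fintype, Fintype.sum_bool]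
  simp

/-- The decision tree that outputs one input bit. -/
def dictator {n : ℕ} (i : Fin n) : DecisionTree n :=
  ⟨.query i (.leaf false) (.leaf true), by simp [Tree.ReadOnceAvoiding]⟩

/-- The decision tree that makes no queries. -/
def constant {n : ℕ} (b : Bool) : DecisionTree n := ⟨.leaf b, trivial⟩

/-- The tree that queries all positions in `l` and outputs `b` if and only if an even number of
them is one. -/
def parityTree {n : ℕ} : List (Fin n) → Bool → Tree n
  | [], b => .leaf b
  | i :: l, b => .query i (parityTree l b) (parityTree l (!b))

theorem cost_parityTree {n : ℕ} (l : List (Fin n)) (b : Bool) (x : Fin n → Bool) :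
    (parityTree l b).cost x = l.length := by
  induction l generalizing b with
  | nil => rfl
  | cons i l ih => simp [parityTree, Tree.cost, ih, add_comm]

theorem eval_parityTree {n : ℕ} (l : List (Fin n)) (b : Bool) (x : Fin n → Bool) :
    (parityTree l b).eval x = if Even (l.countP x) then b else !b := by
  induction l generalizing b with
  | nil => simp [parityTree, Tree.eval]
  | cons i l ih =>
    simp only [parityTree, Tree.eval, ih, List.countP_cons]
    cases hx : x i
    · simp
    · by_cases h : Even (l.countP x) <;> simp [h, Nat.even_add_one]

theorem readOnceAvoiding_parityTree {n : ℕ} (l : List (Fin n)) (b : Bool) (S : Finset (Fin n))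
    (hl : l.Nodup) (hS : ∀ i ∈ l, i ∉ S) : (parityTree l b).ReadOnceAvoiding S := by
  induction l generalizing b S with
  | nil => trivial
  | cons i l ih =>
    rw [List.nodup_cons] at hl
    have h : ∀ j ∈ l, j ∉ insert i S := by
      intro j hj hmem
      rcases Finset.mem_insert.mp hmem with rfl | hj'
      · exact hl.1 hj
      · exact hS j (List.mem_cons_of_mem _ hj) hj'
    exact ⟨hS i List.mem_cons_self, ih _ _ hl.2 h, ih _ _ hl.2 h⟩

theorem card_filter_role {n : ℕ} (role : Fin n → Role) (k : Role) (b : Bool) (x : Fin n → Bool) :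
    ∑ i : {i // role i = k}, (if x i = b then (1 : ℝ) else 0) = count role k b (full x) := by
  rw [← Finset.sum_subtype (Finset.univ.filter fun i => role i = k) (by simp)
    (fun i => if x i = b then (1 : ℝ) else 0), Finset.sum_boole, Finset.filter_filter, count]
  simp [full]

theorem card_role {n : ℕ} (role : Fin n → Role) (k : Role) :
    Fintype.card {i // role i = k} = size role k := by
  rw [Fintype.card_subtype, size]

namespace Layout

variable {n r : ℕ} (Λ : Layout n r)

/-- The payload positions. -/
noncomputable def payload : List (Fin n) := (Finset.univ.filter fun i => Λ.role i = .payload).toList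

theorem length_payload : Λ.payload.length = r ^ 4 := by
  rw [payload, Finset.length_toList]; exact Λ.size_payload

theorem countP_payload (x : Fin n → Bool) :
    Λ.payload.countP x = count Λ.role .payload true (full x) := by
  have h : x = fun i => decide (x i = true) := by funext i; simp
  conv_lhs => rw [h]
  rw [payload, count, ← Multiset.coe_countP, Finset.coe_toList, Multiset.countP_eq_card_filter,
    ← Finset.filter_val, Finset.card_val, Finset.filter_filter]
  simp [full]

/-- Query the flag `j`; output `c` if it is not set, and the parity of the payload otherwise. -/
noncomputable def flagTree (j : {j // Λ.role j = .flag}) (c : Bool) : DecisionTree n :=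
  ⟨.query j (.leaf c) (parityTree Λ.payload true), by
    refine ⟨Finset.notMem_empty _, trivial, readOnceAvoiding_parityTree _ _ _
      (Finset.nodup_toList _) fun i hi hmem => ?_⟩
    simp only [insert_empty_eq, Finset.mem_singleton] at hmem
    rw [payload, Finset.mem_toList, Finset.mem_filter, hmem, j.2] at hi
    exact absurd hi.2 (by decide)⟩

theorem nonempty_role {k : Role} (h : 0 < size Λ.role k) : Nonempty {i // Λ.role i = k} := by
  rw [← Fintype.card_pos_iff, card_role]; exact h

theorem size_flag_pos (hr : 2 ≤ r) : 0 < size Λ.role .flag := by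
  rw [Λ.size_flag]; exact pow_pos (by omega) 2

/-- Output a random vote. -/
noncomputable def pollTree (hN : 0 < size Λ.role .vote) : RandTree n :=
  haveI := Λ.nonempty_role hN
  (PMF.uniformOfFintype {i // Λ.role i = .vote}).map fun i => dictator i.1

/-- Query a random flag. -/
noncomputable def probeTree (hr : 2 ≤ r) : RandTree n :=
  haveI := Λ.nonempty_role (Λ.size_flag_pos hr)
  (PMF.uniformOfFintype ({i // Λ.role i = .flag} × Bool)).map fun i => Λ.flagTree i.1 i.2

/-- With equal probability, output a random vote or query a random flag. -/
noncomputable def cheapTree (hr : 2 ≤ r) (hN : 0 < size Λ.role .vote) : RandTree n :=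
  mix (1 / 2) (by norm_num) (Λ.pollTree hN) (Λ.probeTree hr)

theorem cost_pollTree (hN : 0 < size Λ.role .vote) (x : Fin n → Bool) :
    cost (Λ.pollTree hN) x = 1 := by
  rw [cost, pollTree, expect_map]
  simp [dictator, Tree.cost, expect_const]

theorem err_pollTree (hN : 0 < size Λ.role .vote) {f : PartialFn n} {x : Fin n → Bool} {b : Bool}
    (hf : f x = some b) : err f (Λ.pollTree hN) x =
      ENNReal.ofReal ((count Λ.role .vote (!b) (full x) : ℝ) / size Λ.role .vote) := by
  have := Λ.nonempty_role hN
  rw [err, pollTree, expect_map, ← card_filter_role, ← card_role, ← expect_uniform]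
  · congr 1
    funext i
    rw [hf]
    cases hx : x i <;> cases b <;> simp [dictator, Tree.eval, hx]
  · intro i; split <;> norm_num

/-- Each set flag is hit with probability 1/r² and then costs r⁴ further queries. -/
theorem cost_probeTree (hr : 2 ≤ r) (x : Fin n → Bool) :
    cost (Λ.probeTree hr) x =
      ENNReal.ofReal (1 + count Λ.role .flag true (full x) * (r : ℝ) ^ 2) := by
  have := Λ.nonempty_role (Λ.size_flag_pos hr)
  have hr1 : (0 : ℝ) < r := by exact_mod_cast (by omega : 0 < r)
  rw [cost, probeTree, expect_map]
  have e : ∀ i : {i // Λ.role i = .flag} × Bool,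
      (((Λ.flagTree i.1 i.2).1.cost x : ℕ) : ℝ≥0∞) =
        ENNReal.ofReal (1 + (if x i.1 = true then 1 else 0) * (r : ℝ) ^ 4) := by
    intro i
    rw [← ENNReal.ofReal_natCast]
    congr 1
    cases hx : x i.1 <;> simp [flagTree, Tree.cost, hx, cost_parityTree, length_payload]
  simp only [e]
  rw [expect_uniform]
  · congr 1
    rw [Fintype.sum_prod_type]
    simp only [Fintype.sum_bool, Fintype.card_prod, card_role, Λ.size_flag, Fintype.card_bool,
      Finset.sum_add_distrib, ← Finset.sum_mul, card_filter_role]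
    rw [Finset.sum_const, Finset.card_univ, card_role, Λ.size_flag]
    push_cast
    field_simp
    ring
  · intro i; positivity

/-- Errors arise only at unset flags, where the output is a fair coin. -/
theorem err_probeTree (hr : 2 ≤ r) {f : PartialFn n} {x : Fin n → Bool} {b : Bool}
    (hf : f x = some b) (h : count Λ.role .flag true (full x) ≠ 0 →
      b = decide (Even (count Λ.role .payload true (full x)))) :
    err f (Λ.probeTree hr) x =
      ENNReal.ofReal ((count Λ.role .flag false (full x) : ℝ) / (2 * (r : ℝ) ^ 2)) := by
  have := Λ.nonempty_role (Λ.size_flag_pos hr)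
  have hr1 : (0 : ℝ) < r := by exact_mod_cast (by omega : 0 < r)
  rw [err, probeTree, expect_map]
  have e : ∀ i : {i // Λ.role i = .flag} × Bool,
      (if some ((Λ.flagTree i.1 i.2).1.eval x) = f x then (0 : ℝ≥0∞) else 1) =
        ENNReal.ofReal ((if x i.1 = false then 1 else 0) * (if i.2 = b then 0 else 1)) := by
    intro i
    rw [hf]
    cases hx : x i.1
    · simp [flagTree, Tree.eval, hx]
      split <;> simp
    · have hb : b = decide (Even (count Λ.role .payload true (full x))) := by
        have : 0 < count Λ.role .flag true (full x) :=
          Finset.card_pos.mpr ⟨i.1, by simp [full, hx, i.1.2]⟩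
        exact h this.ne'
      have : (Λ.flagTree i.1 i.2).1.eval x = b := by
        simp only [flagTree, Tree.eval, hx, if_true, eval_parityTree, countP_payload]
        rw [hb]
        split <;> simp_all
      simp [this]
  simp only [e]
  rw [expect_uniform]
  · congr 1
    rw [Fintype.sum_prod_type]
    have e2 : ∀ c : ℝ, c * (if true = b then 0 else 1) + c * (if false = b then 0 else 1) = c := by
      intro c; cases b <;> simp
    simp only [Fintype.sum_bool, Fintype.card_prod, card_role, Λ.size_flag, Fintype.card_bool, e2,
      card_filter_role]
    push_cast
    rw [mul_comm (2 : ℝ)]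
  · intro i; split <;> split <;> norm_num

/-- Ensures that the mixing weight in `expD_le_one` is at most one. -/
theorem one_le_cost_cheapTree (hr : 2 ≤ r) (hN : 0 < size Λ.role .vote) (x : Fin n → Bool) :
    1 ≤ cost (Λ.cheapTree hr hN) x := by
  have h : cost (Λ.cheapTree hr hN) x = ENNReal.ofReal (1 / 2) * cost (Λ.pollTree hN) x +
    ENNReal.ofReal (1 - 1 / 2) * cost (Λ.probeTree hr) x := expect_mix _ _ _ _
  rw [h, cost_pollTree, cost_probeTree]
  calc (1 : ℝ≥0∞) = ENNReal.ofReal (1 / 2) * 1 + ENNReal.ofReal (1 - 1 / 2) * 1 := by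
        rw [mul_one, mul_one, ← ENNReal.ofReal_add (by norm_num) (by norm_num)]; norm_num
    _ ≤ _ := by
        gcongr
        rw [ENNReal.one_le_ofReal]
        have : 0 ≤ (count Λ.role .flag true (full x) : ℝ) * (r : ℝ) ^ 2 := by positivity
        linarith

/-- The cost of `cheapTree` is proportional to its bias, uniformly over the domain. -/
theorem mul_cost_cheapTree_add_le (hr : 4 ≤ r) (hN : 0 < size Λ.role .vote) {x : Fin n → Bool}
    (hx : x ∈ Λ.fn.Dom) :
    ENNReal.ofReal (1 / (4 * (r : ℝ) ^ 4)) * cost (Λ.cheapTree (by omega) hN) x +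
      2 * err Λ.fn (Λ.cheapTree (by omega) hN) x ≤ 1 := by
  have hr2 : 2 ≤ r := by omega
  have hrR : (4 : ℝ) ≤ r := by exact_mod_cast hr
  have hN' : (0 : ℝ) < size Λ.role .vote := by exact_mod_cast hN
  have h1 : cost (Λ.cheapTree hr2 hN) x = ENNReal.ofReal (1 / 2) * cost (Λ.pollTree hN) x +
    ENNReal.ofReal (1 - 1 / 2) * cost (Λ.probeTree hr2) x := expect_mix _ _ _ _
  have h2 : err Λ.fn (Λ.cheapTree hr2 hN) x = ENNReal.ofReal (1 / 2) *
    err Λ.fn (Λ.pollTree hN) x + ENNReal.ofReal (1 - 1 / 2) * err Λ.fn (Λ.probeTree hr2) x :=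
    expect_mix _ _ _ _
  obtain ⟨b, hb⟩ := Option.ne_none_iff_exists'.mp hx
  have hv : (count Λ.role .vote true (full x) : ℝ) + count Λ.role .vote false (full x) =
      size Λ.role .vote := by exact_mod_cast count_full_add Λ.role .vote x
  have hfl : (count Λ.role .flag true (full x) : ℝ) + count Λ.role .flag false (full x) =
      (r : ℝ) ^ 2 := by
    have := count_full_add Λ.role .flag x
    rw [Λ.size_flag] at this
    exact_mod_cast this
  have hpar : count Λ.role .flag true (full x) ≠ 0 →
      b = decide (Even (count Λ.role .payload true (full x))) := by
    intro h0
    unfold fn at hb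
    rw [if_neg h0] at hb
    split_ifs at hb
    exact (Option.some.inj hb).symm
  rw [h1, h2, cost_pollTree, cost_probeTree, Λ.err_pollTree hN hb, Λ.err_probeTree hr2 hb hpar,
    ← ENNReal.ofReal_one, show (2 : ℝ≥0∞) = ENNReal.ofReal 2 by simp]
  rw [← ENNReal.ofReal_mul (by positivity), ← ENNReal.ofReal_mul (by norm_num),
    ← ENNReal.ofReal_mul (by positivity), ← ENNReal.ofReal_mul (by norm_num),
    ← ENNReal.ofReal_add (by positivity) (by norm_num; positivity),
    ← ENNReal.ofReal_add (by positivity) (by norm_num; positivity),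
    ← ENNReal.ofReal_mul (by positivity), ← ENNReal.ofReal_mul (by positivity),
    ← ENNReal.ofReal_add (by norm_num; positivity) (by norm_num; positivity)]
  refine ENNReal.ofReal_le_ofReal ?_
  have hc : (count Λ.role .vote (!b) (full x) : ℝ) =
      (size Λ.role .vote - sgn b * lead Λ.role (full x)) / 2 := by
    rw [← hv, lead]; cases b <;> simp [sgn] <;> ring
  have hq : (count Λ.role .vote (!b) (full x) : ℝ) / size Λ.role .vote =
      1 / 2 - sgn b * lead Λ.role (full x) / size Λ.role .vote / 2 := by
    rw [hc]; field_simp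
  rw [hq]
  by_cases h0 : count Λ.role .flag true (full x) = 0
  · rw [h0] at hfl ⊢
    have hz : (count Λ.role .flag false (full x) : ℝ) = (r : ℝ) ^ 2 := by simpa using hfl
    -- Probing is a coin flip here, so polling supplies all the bias; the constant in 1/(4r⁴) is
    -- tight at the least margin.
    have hs : 1 / (2 * (r : ℝ) ^ 4) ≤ sgn b * lead Λ.role (full x) / size Λ.role .vote := by
      rw [le_div_iff₀ hN', one_div_mul_eq_div]
      unfold fn at hb
      rw [if_pos h0] at hb
      split_ifs at hb with c1 c2
      · rw [← Option.some.inj hb, sgn_true]; linarith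
      · rw [← Option.some.inj hb, sgn_false]; linarith
    have e1 : (count Λ.role .flag false (full x) : ℝ) / (2 * (r : ℝ) ^ 2) = 1 / 2 := by
      rw [hz]; field_simp
    have e2 : 1 / (4 * (r : ℝ) ^ 4) = 1 / (2 * (r : ℝ) ^ 4) / 2 := by ring
    rw [e1, e2]
    push_cast
    linarith
  · unfold fn at hb
    rw [if_neg h0] at hb
    split_ifs at hb with c1
    obtain ⟨h1, hS⟩ := c1
    rw [h1] at hfl ⊢
    have hz : (count Λ.role .flag false (full x) : ℝ) = (r : ℝ) ^ 2 - 1 := by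
      push_cast at hfl; linarith
    -- Misleading votes lose at most 1/r³ of bias against the 1/(2r²) gained by probing; r ≥ 4
    -- leaves room for the cost term.
    have hs : -(2 / (r : ℝ) ^ 3) ≤ sgn b * lead Λ.role (full x) / size Λ.role .vote := by
      have habs : |sgn b * lead Λ.role (full x) / size Λ.role .vote| ≤ 2 / (r : ℝ) ^ 3 := by
        rw [abs_div, abs_mul, abs_sgn, one_mul, abs_of_pos hN', div_le_iff₀ hN']
        refine hS.trans_eq (by ring)
      exact (abs_le.mp habs).1
    have e1 : (count Λ.role .flag false (full x) : ℝ) / (2 * (r : ℝ) ^ 2) =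
        1 / 2 - 1 / (r : ℝ) ^ 2 / 2 := by
      rw [hz]; field_simp
    have hinv : 1 / (r : ℝ) ≤ 1 / 4 := one_div_le_one_div_of_le (by norm_num) hrR
    have hp : 0 < 1 / (r : ℝ) := by positivity
    have e3 : 1 / (4 * (r : ℝ) ^ 4) = (1 / (r : ℝ)) ^ 4 / 4 := by field_simp
    have e4 : 2 / (r : ℝ) ^ 3 = 2 * (1 / (r : ℝ)) ^ 3 := by field_simp
    have e5 : 1 / (r : ℝ) ^ 2 = (1 / (r : ℝ)) ^ 2 := by field_simp
    have e6 : (1 / (r : ℝ)) ^ 4 / 4 * (r : ℝ) ^ 2 = (1 / (r : ℝ)) ^ 2 / 4 := by field_simp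
    have e7 : (1 / (r : ℝ)) ^ 3 ≤ (1 / (r : ℝ)) ^ 2 / 4 := by nlinarith [sq_nonneg (1 / (r : ℝ))]
    have e8 : (1 / (r : ℝ)) ^ 4 ≤ (1 / (r : ℝ)) ^ 2 / 16 := by
      nlinarith [sq_nonneg (1 / (r : ℝ)), pow_pos hp 3]
    rw [e1, e3]
    rw [e4] at hs
    rw [e5]
    push_cast
    have e9 : 0 ≤ (1 / (r : ℝ)) ^ 2 := by positivity
    nlinarith

/-- Against every single distribution, one query on average suffices. -/
theorem expD_le_one (hr : 4 ≤ r) (hN : 0 < size Λ.role .vote) :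
    expD (ENNReal.ofReal ((1 - 1 / (4 * (r : ℝ) ^ 4)) / 2)) Λ.fn ≤ 1 := by
  have hr2 : 2 ≤ r := by omega
  have hrR : (4 : ℝ) ≤ r := by exact_mod_cast hr
  refine iSup_le fun μ => ?_
  set δ : ℝ := 1 / (4 * (r : ℝ) ^ 4) with hδ
  have hδ0 : 0 < δ := by positivity
  set R := Λ.cheapTree hr2 hN
  have hK : 1 ≤ expect μ fun x => cost R x := by
    rw [← expect_const μ 1]
    exact expect_mono μ fun x => Λ.one_le_cost_cheapTree hr2 hN x
  have hKE : ENNReal.ofReal δ * expect μ (fun x => cost R x) +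
      2 * expect μ (fun x => err Λ.fn R x) ≤ 1 := by
    rw [← expect_const_mul, ← expect_const_mul, ← expect_add]
    refine (expect_mono μ fun x => ?_).trans_eq (expect_const μ 1)
    exact Λ.mul_cost_cheapTree_add_le hr hN x.2
  generalize hKdef : expect μ (fun x => cost R x) = K at hK hKE
  generalize hEdef : expect μ (fun x => err Λ.fn R x) = E at hKE
  have hKfin : K ≠ ⊤ := by
    rintro rfl
    rw [ENNReal.mul_top (by simpa using hδ0)] at hKE
    simp at hKE
  have hEfin : E ≠ ⊤ := by
    rintro rfl
    rw [ENNReal.mul_top (by norm_num)] at hKE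
    simp at hKE
  obtain ⟨k, hk0, rfl⟩ : ∃ k : ℝ, 0 ≤ k ∧ ENNReal.ofReal k = K :=
    ⟨K.toReal, ENNReal.toReal_nonneg, ENNReal.ofReal_toReal hKfin⟩
  obtain ⟨e, he0, rfl⟩ : ∃ e : ℝ, 0 ≤ e ∧ ENNReal.ofReal e = E :=
    ⟨E.toReal, ENNReal.toReal_nonneg, ENNReal.ofReal_toReal hEfin⟩
  rw [ENNReal.one_le_ofReal] at hK
  rw [show (2 : ℝ≥0∞) = ENNReal.ofReal 2 by simp, ← ENNReal.ofReal_mul hδ0.le,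
    ← ENNReal.ofReal_mul (by norm_num), ← ENNReal.ofReal_add (by positivity) (by positivity),
    ENNReal.ofReal_le_one] at hKE
  -- The bias 1 − 2e is at least δ k ≥ δ. Running `R` with probability t = δ/(1 − 2e) and a fair
  -- coin otherwise has bias exactly δ and cost t k ≤ 1.
  have hpos : 0 < 1 - 2 * e := by nlinarith
  have ht : 0 ≤ δ / (1 - 2 * e) ∧ δ / (1 - 2 * e) ≤ 1 :=
    ⟨by positivity, by rw [div_le_one hpos]; nlinarith⟩
  have hmul : δ / (1 - 2 * e) * (1 - 2 * e) = δ := div_mul_cancel₀ _ hpos.ne'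
  set t := δ / (1 - 2 * e)
  set Q : RandTree n := (PMF.uniformOfFintype Bool).map constant with hQ
  have hQc : ∀ x, cost Q x = 0 := by
    intro x
    rw [cost, hQ, expect_map]
    simp [constant, Tree.cost, expect]
  have hQe : ∀ x : Λ.fn.Dom, err Λ.fn Q x = ENNReal.ofReal (1 / 2) := by
    intro x
    obtain ⟨b, hb⟩ := Option.ne_none_iff_exists'.mp x.2
    rw [err, hQ, expect_map, hb]
    have := expect_uniform (fun c : Bool => if c = b then (0 : ℝ) else 1)
      (fun c => by split <;> norm_num)
    rw [Fintype.sum_bool, Fintype.card_bool] at this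
    convert this using 1
    · congr 1
      funext c
      by_cases hc : c = b <;> simp [constant, Tree.eval, hc]
    · cases b <;> simp
  refine iInf_le_of_le (mix t ht R Q) (iInf_le_of_le ?_ ?_)
  · have h1 : ∀ x : Λ.fn.Dom, err Λ.fn (mix t ht R Q) x = ENNReal.ofReal t * err Λ.fn R x +
        ENNReal.ofReal (1 - t) * ENNReal.ofReal (1 / 2) := fun x => by
      rw [← hQe x]; exact expect_mix _ _ _ _
    simp only [h1]
    rw [expect_add, expect_const_mul, expect_const, hEdef, ← ENNReal.ofReal_mul ht.1,
      ← ENNReal.ofReal_mul (by linarith [ht.2]), ← ENNReal.ofReal_add (mul_nonneg ht.1 he0)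
        (mul_nonneg (by linarith [ht.2]) (by norm_num))]
    refine ENNReal.ofReal_le_ofReal ?_
    linarith
  · have h1 : ∀ x : Λ.fn.Dom, cost (mix t ht R Q) x = ENNReal.ofReal t * cost R x := fun x => by
      rw [← add_zero (ENNReal.ofReal t * _), ← mul_zero (ENNReal.ofReal (1 - t)), ← hQc x]
      exact expect_mix _ _ _ _
    simp only [h1]
    rw [expect_const_mul, hKdef, ← ENNReal.ofReal_mul ht.1, ENNReal.ofReal_le_one]
    have h2 := mul_le_mul_of_nonneg_left (by linarith : δ * k ≤ 1 - 2 * e) ht.1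
    rw [hmul] at h2
    nlinarith

end Layout

/-! ### The concrete layout and the choice of parameters. -/

/-- The first `r²` positions are flags, the next `r⁴` are payload bits. -/
def standardRole (n r : ℕ) (i : Fin n) : Role :=
  if i.1 < r ^ 2 then .flag else if i.1 < r ^ 2 + r ^ 4 then .payload else .vote

theorem card_filter_fin_Ico {n a b : ℕ} (hb : b ≤ n) :
    (Finset.univ.filter fun i : Fin n => a ≤ i.1 ∧ i.1 < b).card = b - a := by
  rw [← Nat.card_Ico, ← Finset.card_map Fin.valEmbedding]
  congr 1
  ext k
  simp only [Finset.mem_map, Finset.mem_filter, Finset.mem_univ, true_and, Fin.valEmbedding_apply,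
    Finset.mem_Ico]
  constructor
  · rintro ⟨i, hi, rfl⟩; exact hi
  · intro hk; exact ⟨⟨k, by omega⟩, hk, rfl⟩

/-- The standard layout. -/
def standardLayout (n r : ℕ) (h : r ^ 2 + r ^ 4 ≤ n) : Layout n r where
  role := standardRole n r
  size_flag := by
    rw [size, ← Nat.sub_zero (r ^ 2), ← card_filter_fin_Ico (n := n) (by omega : r ^ 2 ≤ n)]
    congr 1
    ext i
    simp only [Finset.mem_filter, Finset.mem_univ, true_and, zero_le]
    unfold standardRole
    split_ifs <;> simp_all
  size_payload := by
    rw [size, ← Nat.add_sub_cancel_left (n := r ^ 2) (m := r ^ 4), ← card_filter_fin_Ico h]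
    congr 1
    ext i
    simp only [Finset.mem_filter, Finset.mem_univ, true_and]
    unfold standardRole
    split_ifs <;> simp_all

theorem size_vote_standardLayout {n r : ℕ} (h : r ^ 2 + r ^ 4 ≤ n) :
    size (standardLayout n r h).role .vote = n - (r ^ 2 + r ^ 4) := by
  rw [size, ← card_filter_fin_Ico (n := n) le_rfl]
  congr 1
  ext i
  have := i.2
  simp only [Finset.mem_filter, Finset.mem_univ, true_and]
  change standardRole n r i = .vote ↔ _
  unfold standardRole
  split_ifs <;> simp_all <;> omega

/-- With enough votes, the worst-case complexity is at least linear in `r`. -/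
theorem Layout.le_expR {n r : ℕ} (Λ : Layout n r) (hr : 32 ≤ r)
    (hN : (r : ℝ) ^ 16 / 2 ≤ size Λ.role .vote) :
    ENNReal.ofReal (r / 224) ≤ expR (ENNReal.ofReal ((1 - 1 / (4 * (r : ℝ) ^ 4)) / 2)) Λ.fn := by
  have hrR : (32 : ℝ) ≤ r := by exact_mod_cast hr
  have hr0 : (0 : ℝ) < r := by linarith
  have hN' : (0 : ℝ) < size Λ.role .vote := lt_of_lt_of_le (by positivity) hN
  have hN0 : 0 < size Λ.role .vote := by exact_mod_cast hN'
  refine le_iInf₂ fun R hR => ?_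
  by_cases htop : ⨆ x ∈ Λ.fn.Dom, cost R x = ⊤
  · rw [htop]; exact le_top
  obtain ⟨C, hC, hCe⟩ : ∃ C : ℝ, 0 ≤ C ∧ ENNReal.ofReal C = ⨆ x ∈ Λ.fn.Dom, cost R x :=
    ⟨_, ENNReal.toReal_nonneg, ENNReal.ofReal_toReal htop⟩
  rw [← hCe]
  have hδ1 : 1 / (4 * (r : ℝ) ^ 4) ≤ 1 := by
    rw [div_le_one (by positivity)]
    nlinarith [one_le_pow₀ (by linarith : (1 : ℝ) ≤ r) (n := 4)]
  have key := Λ.two_mul_bias_le (by omega) hN0 R (by positivity) hδ1 hC hR fun x hx => by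
    rw [hCe]; exact le_iSup₂ (f := fun x (_ : x ∈ Λ.fn.Dom) => cost R x) x hx
  have hq : ∀ c : ℝ, 0 ≤ c → c * (r : ℝ) ^ 8 / size Λ.role .vote ≤ 2 * c / (r : ℝ) ^ 8 := by
    intro c hc
    calc _ ≤ c * (r : ℝ) ^ 8 / ((r : ℝ) ^ 16 / 2) := by gcongr
      _ = _ := by field_simp
  have q1 := hq 32 (by norm_num)
  have q2 := hq 16 (by norm_num)
  have k2 : 2 * (1 / (4 * (r : ℝ) ^ 4)) ≤ 2 * 32 / (r : ℝ) ^ 8 +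
      14 / (r : ℝ) ^ 5 * (4 * C + (r : ℝ) ^ 6 * (2 * 16 / (r : ℝ) ^ 8)) :=
    key.trans (by gcongr)
  have k3 := mul_le_mul_of_nonneg_right k2 (by positivity : (0 : ℝ) ≤ (r : ℝ) ^ 8)
  have e1 : 2 * (1 / (4 * (r : ℝ) ^ 4)) * (r : ℝ) ^ 8 = (r : ℝ) ^ 4 / 2 := by field_simp; norm_num
  have e2 : (2 * 32 / (r : ℝ) ^ 8 + 14 / (r : ℝ) ^ 5 *
      (4 * C + (r : ℝ) ^ 6 * (2 * 16 / (r : ℝ) ^ 8))) * (r : ℝ) ^ 8 =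
      64 + 56 * C * (r : ℝ) ^ 3 + 448 * r := by field_simp; ring
  rw [e1, e2] at k3
  -- If C < r/224 then 56 C r³ < r⁴/4, and the remaining r⁴/4 exceeds 64 + 448 r.
  refine ENNReal.ofReal_le_ofReal ?_
  by_contra hlt
  rw [not_le, lt_div_iff₀ (by norm_num)] at hlt
  have h3 : 0 < (r : ℝ) ^ 3 := by positivity
  have := mul_lt_mul_of_pos_right hlt h3
  have h4 : (32 : ℝ) ^ 3 * r ≤ (r : ℝ) ^ 4 := by
    calc (32 : ℝ) ^ 3 * r ≤ (r : ℝ) ^ 3 * r := by gcongr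
      _ = _ := by ring
  rw [show (r : ℝ) * (r : ℝ) ^ 3 = (r : ℝ) ^ 4 by ring] at this
  linarith

/-- The largest `r` with `r¹⁶ ≤ n`. -/
noncomputable def root (n : ℕ) : ℕ := ⌊(n : ℝ) ^ (1 / 16 : ℝ)⌋₊

theorem tendsto_root : Tendsto root atTop atTop :=
  tendsto_nat_floor_atTop.comp
    ((tendsto_rpow_atTop (by norm_num)).comp tendsto_natCast_atTop_atTop)

theorem root_pow_le (n : ℕ) : root n ^ 16 ≤ n := by
  have h : (root n : ℝ) ≤ (n : ℝ) ^ (1 / 16 : ℝ) := Nat.floor_le (by positivity)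
  have h2 := pow_le_pow_left₀ (by positivity) h 16
  rw [← Real.rpow_natCast ((n : ℝ) ^ (1 / 16 : ℝ)), ← Real.rpow_mul (by positivity)] at h2
  norm_num at h2
  exact_mod_cast h2

open Classical in
/-- The separating functions, indexed by the number of input bits. -/
noncomputable def separating (n : ℕ) : PartialFn n :=
  if h : root n ^ 2 + root n ^ 4 ≤ n then (standardLayout n (root n) h).fn else fun _ => none

/-- The biases. -/
noncomputable def bias (n : ℕ) : ℝ := 1 / (4 * ((max (root n) 1 : ℕ) : ℝ) ^ 4)

theorem bias_pos (n : ℕ) : 0 < bias n := by unfold bias; positivity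

theorem bias_lt_one (n : ℕ) : bias n < 1 := by
  -- The maximum with 1 in `bias` avoids division by zero when `root n = 0`.
  have h : (1 : ℝ) ≤ ((max (root n) 1 : ℕ) : ℝ) := by exact_mod_cast le_max_right _ _
  unfold bias
  rw [div_lt_one (by positivity)]
  linarith [one_le_pow₀ h (n := 4)]

theorem tendsto_bias : Tendsto bias atTop (𝓝 0) := by
  have h1 : Tendsto (fun n => ((max (root n) 1 : ℕ) : ℝ)) atTop atTop :=
    tendsto_natCast_atTop_atTop.comp (tendsto_atTop_mono (fun n => le_max_left _ _) tendsto_root)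
  have h2 := ((tendsto_pow_atTop (by norm_num : (4 : ℕ) ≠ 0)).comp h1).const_mul_atTop
    (by norm_num : (0 : ℝ) < 4)
  refine (tendsto_const_nhds (x := (1 : ℝ))).div_atTop h2

/-- Halving the exponent 1/16 absorbs the constant: (r/224)² ≥ 4r ≥ r + 1 > n^(1/16) once r ≥ 448².
-/
theorem rpow_le_root_div {n : ℕ} (h : 448 ^ 2 ≤ root n) :
    (n : ℝ) ^ (1 / 32 : ℝ) ≤ (root n : ℝ) / 224 := by
  have h1 : (n : ℝ) ^ (1 / 16 : ℝ) < root n + 1 := Nat.lt_floor_add_one _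
  have hR : (448 : ℝ) ^ 2 ≤ root n := by exact_mod_cast h
  have h0 : (0 : ℝ) ≤ (n : ℝ) ^ (1 / 32 : ℝ) := by positivity
  have h2 : ((n : ℝ) ^ (1 / 32 : ℝ)) ^ 2 = (n : ℝ) ^ (1 / 16 : ℝ) := by
    rw [← Real.rpow_natCast, ← Real.rpow_mul (by positivity)]; norm_num
  refine abs_le_of_sq_le_sq' ?_ (by positivity) |>.2
  rw [h2]
  nlinarith

end QueryComplexity

theorem theorem1p5 :
    ∃ c : ℝ, 0 < c ∧
      ∃ (f : ∀ n : ℕ, QueryComplexity.PartialFn n) (δ : ℕ → ℝ),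
        (∀ n, 0 < δ n ∧ δ n < 1) ∧
        Tendsto δ atTop (𝓝 0) ∧
        ∀ᶠ n : ℕ in atTop,
          (n : ℝ≥0∞) ^ c ≤ QueryComplexity.expR (ENNReal.ofReal ((1 - δ n) / 2)) (f n) ∧
          QueryComplexity.expD (ENNReal.ofReal ((1 - δ n) / 2)) (f n) ^ (1 + c) ≤
            QueryComplexity.expR (ENNReal.ofReal ((1 - δ n) / 2)) (f n) := by
  open QueryComplexity in
  refine ⟨1 / 32, by norm_num, separating, bias, fun n => ⟨bias_pos n, bias_lt_one n⟩,
    tendsto_bias, ?_⟩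
  filter_upwards [tendsto_root.eventually_ge_atTop (448 ^ 2)] with n hn
  have hle := root_pow_le n
  have hpow := rpow_le_root_div hn
  have hb : bias n = 1 / (4 * (root n : ℝ) ^ 4) := by
    unfold bias; rw [max_eq_left (by omega)]
  have hs : ∀ h : root n ^ 2 + root n ^ 4 ≤ n,
      separating n = (standardLayout n (root n) h).fn := fun h => dif_pos h
  have hn0 : n ≠ 0 := by rintro rfl; exact absurd (pow_pos (by omega : 0 < root 0) 16) (by omega)
  rw [hb]
  generalize root n = r at *
  have h2 : 2 * (r ^ 2 + r ^ 4) ≤ r ^ 16 := by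
    have hr1 : 1 ≤ r := by omega
    have a1 : r ^ 2 ≤ r ^ 4 := Nat.pow_le_pow_right hr1 (by norm_num)
    have a2 : r ^ 5 ≤ r ^ 16 := Nat.pow_le_pow_right hr1 (by norm_num)
    have a3 : 4 * r ^ 4 ≤ r ^ 5 := by rw [pow_succ r 4, mul_comm]; gcongr; omega
    omega
  have h : r ^ 2 + r ^ 4 ≤ n := by omega
  rw [hs h]
  have hv := size_vote_standardLayout h
  set Λ := standardLayout n r h
  have hN : (r : ℝ) ^ 16 / 2 ≤ size Λ.role .vote := by
    have : r ^ 16 ≤ 2 * size Λ.role .vote := by omega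
    have : ((r ^ 16 : ℕ) : ℝ) ≤ ((2 * size Λ.role .vote : ℕ) : ℝ) := by exact_mod_cast this
    push_cast at this
    linarith
  have hN0 : 0 < size Λ.role .vote := by
    have : 0 < r ^ 16 := pow_pos (by omega) 16
    omega
  have hR := Λ.le_expR (by omega) hN
  have hD := Λ.expD_le_one (by omega) hN0
  have hnR : (n : ℝ≥0∞) ^ (1 / 32 : ℝ) ≤
      expR (ENNReal.ofReal ((1 - 1 / (4 * (r : ℝ) ^ 4)) / 2)) Λ.fn := by
    refine le_trans ?_ hR
    rw [← ENNReal.ofReal_natCast, ENNReal.ofReal_rpow_of_nonneg (by positivity) (by norm_num)]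
    exact ENNReal.ofReal_le_ofReal hpow
  -- The distributional complexity is at most 1, hence so is its power, and 1 ≤ n^(1/32).
  refine ⟨hnR, (ENNReal.rpow_le_one hD (by norm_num)).trans (le_trans ?_ hnR)⟩
  exact ENNReal.one_le_rpow (by exact_mod_cast Nat.one_le_iff_ne_zero.mpr hn0) (by norm_num)
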